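/- For an integer $a$ and a natural number $b\ge 1$ let $S(a,b)=12\sum_{k=1}^b((k/b))((ak/b))$ be the normalized Dedekind sum, where $((x))=x-\lfloor x\rfloor-1/2$ for $x\in\mathbb R\setminus\mathbb Z$ and $((x))=0$ for $x\in\mathbb Z$. Let $z$ be a real quadratic irrational, with regular continued fraction expansion $$z=\lfloor a_0,\dots,a_q,\overline{b_1,\dots,b_l}\rfloor=a_0+\cfrac{1}{a_1+\cfrac{1}{a_2+\cdots}}$$ (given by $z_0=z$, $a_j=\lfloor z_j\rfloor$, $z_{j+1}=1/(z_j-a_j)$) and negative regular continued fraction expansion $$z=\lceil c_0,\dots,c_r,\overline{d_1,\dots,d_m}\rceil=c_0-\cfrac{1}{c_1-\cfrac{1}{c_2-\cdots}}$$ (given by $z_0=z$, $c_j=\lceil z_j\rceil$, $z_{j+1}=1/(c_j-z_j)$). Here $l,m\ge 1$ are the least possible period lengths, $q,r$ are least possible for these $l,m$, and $q=-1$, respectively $r=-1$, if the expansion in question is purely periodic. Let $p_k/q_k$ and $s_j/t_j$ be the convergents of the regular and of the negative regular expansion of $z$, respectively. Let $L=l$ if $l$ is even and $L=2l$ if $l$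 is odd, so that $(b_1,\dots,b_L)$ is also a period. For $1\le h\le L$ and $1\le i\le m$ put $$u_h=\lfloor\overline{b_h,b_{h-1},\dots,b_1,b_L,b_{L-1},\dots,b_{h+1}}\rfloor,\qquad v_i=\lceil\overline{d_i,d_{i-1},\dots,d_1,d_m,d_{m-1},\dots,d_{i+1}}\rceil,$$ $$U_h=\sum_{k=0}^q(-1)^{k-1}a_k+(-1)^q\sum_{k=1}^h(-1)^{k-1}b_k+\begin{cases}z+1/u_h-3&\text{if } q+h \text{ is odd},\\ z-1/u_h&\text{if } q+h\text{ is even},\end{cases}$$ $$V_i=\sum_{j=0}^r(3-c_j)+\sum_{j=1}^i(3-d_j)+z-\frac1{v_i}-3 .$$ Suppose that $D=\frac1m\sum_{j=1}^m d_j=3$. Then $U_h=\lim_{n\to\infty}S(p_{q+nL+h},q_{q+nL+h})$ for $1\le h\le L$ and $V_i=\lim_{n\to\infty}S(s_{r+nm+i},t_{r+nm+i})$ for $1\le i\le m$; that is, the $U_h$ and the $V_i$ are the cluster points of the Dedekind sums of the two kinds of convergents. Moreover: 1. If $i\in\{1,\dots,m\}$ is such that $d_{i+1}\ge 3$ (for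 $i=m$ this means $d_1\ge 3$), then $V_i=U_h$ for some $h\in\{1,\dots,L\}$ with $q+h$ odd. 2. If $h\in\{1,\dots,L\}$ and $q+h$ is even, then $U_h\ne V_i$ for all $i\in\{1,\dots,m\}$. -/

import Mathlib

open Filter Topology

/-- A real quadratic irrational: an irrational root of a quadratic polynomial over `ℤ`. -/
def IsQuadraticIrrational (z : ℝ) : Prop :=
  Irrational z ∧ ∃ a b c : ℤ, a ≠ 0 ∧ (a : ℝ) * z ^ 2 + b * z + c = 0

/-! Dedekind sums -/

open Classical in
/-- The sawtooth function `((x))`. -/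
noncomputable def sawtooth (x : ℝ) : ℝ :=
  if x ∈ Set.range ((↑) : ℤ → ℝ) then 0 else x - ⌊x⌋ - 1 / 2

/-- The normalized Dedekind sum `S(a, b) = 12 s(a, b)`, for an integer `a` and an integer `b ≥ 1`. -/
noncomputable def dedekindS (a b : ℤ) : ℝ :=
  12 * ∑ k ∈ Finset.Icc 1 b, sawtooth ((k : ℝ) / b) * sawtooth ((a : ℝ) * k / b)

/-! Regular continued fractions -/

/-- The complete quotients `z_j` of the regular continued fraction algorithm. -/
noncomputable def regQuot (z : ℝ) : ℕ → ℝ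
  | 0 => z
  | j + 1 => 1 / (regQuot z j - ⌊regQuot z j⌋)

/-- The partial quotients `a_j` of the regular continued fraction expansion of `z`. -/
noncomputable def regDigit (z : ℝ) (j : ℕ) : ℤ := ⌊regQuot z j⌋

/-- Numerators `p_k` of the convergents of `⌊a_0, a_1, …⌋`. -/
def regNum (a : ℕ → ℤ) : ℕ → ℤ
  | 0 => a 0
  | 1 => a 1 * a 0 + 1
  | k + 2 => a (k + 2) * regNum a (k + 1) + regNum a k

/-- Denominators `q_k` of the convergents of `⌊a_0, a_1, …⌋`. -/
def regDen (a : ℕ → ℤ) : ℕ → ℤ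
  | 0 => 1
  | 1 => a 1
  | k + 2 => a (k + 2) * regDen a (k + 1) + regDen a k

/-- The value of the infinite regular continued fraction `⌊a_0, a_1, …⌋`
(the limit of its convergents; used for positive integers `a_j` only). -/
noncomputable def regValue (a : ℕ → ℤ) : ℝ :=
  limUnder atTop (fun k => (regNum a k : ℝ) / regDen a k)

/-! Negative regular continued fractions -/

/-- The complete quotients `z_j` of the negative regular continued fraction algorithm. -/
noncomputable def negQuot (z : ℝ) : ℕ → ℝ
  | 0 => z
  | j + 1 => 1 / (⌈negQuot z j⌉ - negQuot z j)

/-- The partial quotients `c_j` of the negative regular continued fraction expansion of `z`. -/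
noncomputable def negDigit (z : ℝ) (j : ℕ) : ℤ := ⌈negQuot z j⌉

/-- Numerators `s_j` of the convergents of `⌈c_0, c_1, …⌉`. -/
def negNum (c : ℕ → ℤ) : ℕ → ℤ
  | 0 => c 0
  | 1 => c 1 * c 0 - 1
  | j + 2 => c (j + 2) * negNum c (j + 1) - negNum c j

/-- Denominators `t_j` of the convergents of `⌈c_0, c_1, …⌉`. -/
def negDen (c : ℕ → ℤ) : ℕ → ℤ
  | 0 => 1
  | 1 => c 1
  | j + 2 => c (j + 2) * negDen c (j + 1) - negDen c j

/-- The value of the infinite negative regular continued fraction `⌈c_0, c_1, …⌉`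
(the limit of its convergents; used for integers `c_j ≥ 2` only). -/
noncomputable def negValue (c : ℕ → ℤ) : ℝ :=
  limUnder atTop (fun j => (negNum c j : ℝ) / negDen c j)

/-! Periods -/

/-- The sequence `a` is eventually periodic, `l ≥ 1` is its least period length, and `N` is the
least length of a pre-period for this `l`. Thus `a = (a_0, …, a_{N-1}, overline (b_1, …, b_l))`,
and `N = 0` exactly in the purely periodic case. -/
def IsMinimalPeriod (a : ℕ → ℤ) (N l : ℕ) : Prop :=
  IsLeast {l : ℕ | 1 ≤ l ∧ ∃ N, ∀ n, N ≤ n → a (n + l) = a n} l ∧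
    IsLeast {N : ℕ | ∀ n, N ≤ n → a (n + l) = a n} N

/-- The entry with index `k = 1, 2, …` of the periodic part that follows a pre-period of
length `N`. -/
def periodEntry (a : ℕ → ℤ) (N k : ℕ) : ℤ := a (N + k - 1)

/-- For a period `(b_1, …, b_L)` and `1 ≤ h ≤ L`, the periodic sequence
`overline (b_h, b_{h-1}, …, b_1, b_L, b_{L-1}, …, b_{h+1})`. -/
def reversedPeriod (b : ℕ → ℤ) (L h : ℕ) (n : ℕ) : ℤ :=
  b ((((h : ℤ) - 1 - n) % (L : ℤ)).toNat + 1)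

/-- The least even multiple `L` (namely `l` or `2 * l`) of the period length `l`. -/
def evenPeriod (l : ℕ) : ℕ := if Even l then l else 2 * l

/-- The mean `D` of the entries of the period `(d_1, …, d_m)`. -/
noncomputable def periodMean (d : ℕ → ℤ) (m : ℕ) : ℝ :=
  (1 / (m : ℝ)) * ∑ j ∈ Finset.Icc 1 m, (d j : ℝ)

/-! The cluster points -/

/-- The cluster point `U_h` of the Dedekind sums of the regular convergents of `z`, where `N = q + 1`
is the length of the pre-period `(a_0, …, a_q)` and `l` is the length of the period.
The signs `(-1) ^ q` and `(-1) ^ (k - 1)` are written `(-1) ^ (N + 1)` and `(-1) ^ (k + 1)`. -/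
noncomputable def regCluster (z : ℝ) (N l h : ℕ) : ℝ :=
  let a := regDigit z
  let b := periodEntry a N
  let u := regValue (reversedPeriod b (evenPeriod l) h)
  (∑ k ∈ Finset.range N, (-1 : ℝ) ^ (k + 1) * a k)
    + (-1 : ℝ) ^ (N + 1) * (∑ k ∈ Finset.Icc 1 h, (-1 : ℝ) ^ (k + 1) * b k)
    + if Odd ((N : ℤ) - 1 + h) then z + 1 / u - 3 else z - 1 / u

/-- The cluster point `V_i` of the Dedekind sums of the negative regular convergents of `z`, where
`M = r + 1` is the length of the pre-period `(c_0, …, c_r)` and `m` is the length of the period. -/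
noncomputable def negCluster (z : ℝ) (M m i : ℕ) : ℝ :=
  let c := negDigit z
  let d := periodEntry c M
  let v := negValue (reversedPeriod d m i)
  (∑ j ∈ Finset.range M, (3 - (c j : ℝ))) + (∑ j ∈ Finset.Icc 1 i, (3 - (d j : ℝ)))
    + z - 1 / v - 3

/-! Reciprocity, applied once per digit, evaluates the Dedekind sums of convergents
(`dedekindS_regular`, `dedekindS_negative`). For the regular expansion the result is the alternating
digit sum plus `p_k/q_k`, plus or minus `q_{k-1}/q_k`, with a further `-3` for odd `k`. For the
negative one it is the sum of the `3 - c_j` plus `s_j/t_j - t_{j-1}/t_j - 3`. The convergents tend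
to `z`. The quotients of consecutive denominators are continued fractions in the reversed digits, so
along a residue class they tend to `1/u_h`, respectively `1/v_i` (`CFAdmissible.tendsto_den_ratio`).
The limits therefore exist as soon as the digit sums do not change over a period.

For the negative expansion this is `D = 3`. For the regular one it follows from the conversion
between the expansions: `a_{2i+1}` becomes `a_{2i+1} - 1` digits `2`, and `a_{2i+2}` becomes one
digit `a_{2i+2} + 2`. Up to a constant, the two digit sums agree at block ends
(`sum_negDigit_blockStart`). One is bounded, so the other cannot drift (`sum_regDigit_period`).

Coincidence: the negative convergent just before a digit `≥ 3` is a regular convergent of odd index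
(`conv_blockStart`), so the two sequences of Dedekind sums share infinitely many terms, and a
pigeonhole on residues mod `L` gives `h`. Non-coincidence: for `q + h` even, `U_h = V_i` makes
`1/u_h - 1/v_i` an integer in `(-1, 1)`, so `u_h = v_i`. That is impossible, because the conjugate
of `u_h` is negative and the companion root for `v_i` is positive (`value_one_ne_value_neg_one`). -/

/-! ### Dedekind sums and the reciprocity law -/

theorem sawtooth_intCast (n : ℤ) : sawtooth n = 0 := by
  simp [sawtooth]

theorem sawtooth_add_int (x : ℝ) (n : ℤ) : sawtooth (x + n) = sawtooth x := by
  have h : x + n ∈ Set.range ((↑) : ℤ → ℝ) ↔ x ∈ Set.range ((↑) : ℤ → ℝ) := by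
    constructor
    · rintro ⟨m, hm⟩
      exact ⟨m - n, by push_cast; linarith⟩
    · rintro ⟨m, hm⟩
      exact ⟨m + n, by push_cast; linarith⟩
  by_cases hx : x ∈ Set.range ((↑) : ℤ → ℝ)
  · rw [sawtooth, sawtooth, if_pos hx, if_pos (h.2 hx)]
  · rw [sawtooth, sawtooth, if_neg hx, if_neg (mt h.1 hx), Int.floor_add_intCast, Int.cast_add,
      add_sub_add_right_eq_sub]

theorem sawtooth_eq_fract {x : ℝ} (hx : Int.fract x ≠ 0) : sawtooth x = Int.fract x - 1 / 2 := by
  have h : x ∉ Set.range ((↑) : ℤ → ℝ) := by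
    rintro ⟨m, rfl⟩
    simp at hx
  rw [sawtooth, if_neg h, Int.self_sub_floor]

theorem sawtooth_neg (x : ℝ) : sawtooth (-x) = -sawtooth x := by
  by_cases hx : Int.fract x = 0
  · obtain ⟨m, rfl⟩ := Int.fract_eq_zero_iff.1 hx
    rw [← Int.cast_neg, sawtooth_intCast, sawtooth_intCast, neg_zero]
  · have h : Int.fract (-x) ≠ 0 := by rwa [Ne, Int.fract_neg_eq_zero]
    rw [sawtooth_eq_fract hx, sawtooth_eq_fract h, Int.fract_neg hx]
    ring

theorem dedekindS_add_mul (a b c : ℤ) (hb : 0 < b) : dedekindS (a + c * b) b = dedekindS a b := by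
  have hb' : (b : ℝ) ≠ 0 := by exact_mod_cast hb.ne'
  unfold dedekindS
  congr 1
  refine Finset.sum_congr rfl fun k _ => ?_
  have : ((a + c * b : ℤ) : ℝ) * k / b = (a : ℝ) * k / b + (c * k : ℤ) := by
    push_cast
    field_simp
  rw [this, sawtooth_add_int]

theorem dedekindS_neg (a b : ℤ) : dedekindS (-a) b = -dedekindS a b := by
  unfold dedekindS
  rw [← mul_neg, ← Finset.sum_neg_distrib]
  congr 1
  refine Finset.sum_congr rfl fun k _ => ?_
  have : ((-a : ℤ) : ℝ) * k / b = -((a : ℝ) * k / b) := by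
    push_cast
    ring
  rw [this, sawtooth_neg, mul_neg]

theorem dedekindS_one_right (a : ℤ) : dedekindS a 1 = 0 := by
  have h : sawtooth 1 = 0 := by simpa using sawtooth_intCast 1
  simp [dedekindS, h]

theorem sawtooth_natCast_div {n b : ℕ} (h : n % b ≠ 0) (hb : 0 < b) :
    sawtooth ((n : ℝ) / b) = ((n % b : ℕ) : ℝ) / b - 1 / 2 := by
  have hfr : Int.fract ((n : ℝ) / b) = ((n % b : ℕ) : ℝ) / b := Int.fract_div_natCast_eq_div_natCast_mod
  have hb' : (b : ℝ) ≠ 0 := by exact_mod_cast hb.ne'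
  rw [sawtooth_eq_fract, hfr]
  rw [hfr]
  exact div_ne_zero (by exact_mod_cast h) hb'

/-- Summation over a complete residue system. -/
theorem sum_mul_mod_eq {a b : ℕ} (hab : a.Coprime b) (f : ℕ → ℝ) :
    ∑ k ∈ Finset.range b, f (a * k % b) = ∑ k ∈ Finset.range b, f k := by
  have hinj : Set.InjOn (fun k => a * k % b) (Finset.range b : Set ℕ) := by
    intro x hx y hy hxy
    simp only [Finset.coe_range, Set.mem_Iio] at hx hy
    have h1 : a * x ≡ a * y [MOD b] := hxy
    have h2 := Nat.ModEq.cancel_left_of_coprime (by simpa [Nat.gcd_comm] using hab) h1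
    exact Nat.ModEq.eq_of_lt_of_lt h2 hx hy
  have hmaps : Set.MapsTo (fun k => a * k % b) (Finset.range b : Set ℕ)
      (Finset.range b : Set ℕ) := by
    intro x hx
    simp only [Finset.coe_range, Set.mem_Iio] at hx ⊢
    exact Nat.mod_lt _ (by omega)
  exact Finset.sum_nbij (fun k => a * k % b) (fun k hk => hmaps hk) hinj
    (Finset.surjOn_of_injOn_of_card_le _ hmaps hinj le_rfl) fun _ _ => rfl

theorem sum_range_cast (n : ℕ) : ∑ k ∈ Finset.range n, (k : ℝ) = n * (n - 1) / 2 := by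
  induction n with
  | zero => simp
  | succ n ih => rw [Finset.sum_range_succ, ih]; push_cast; ring

theorem sum_range_cast_sq (n : ℕ) :
    ∑ k ∈ Finset.range n, (k : ℝ) ^ 2 = n * (n - 1) * (2 * n - 1) / 6 := by
  induction n with
  | zero => simp
  | succ n ih => rw [Finset.sum_range_succ, ih]; push_cast; ring

theorem dedekindS_natCast {a b : ℕ} (hb : 0 < b) (hab : a.Coprime b) :
    dedekindS a b =
      12 / (b : ℝ) ^ 2 * ∑ k ∈ Finset.range b, (k : ℝ) * ((a * k % b : ℕ) : ℝ) - 3 * b + 3 := by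
  have hb' : (b : ℝ) ≠ 0 := by exact_mod_cast hb.ne'
  have h1 : ∑ k ∈ Finset.Icc (1 : ℤ) b, sawtooth ((k : ℝ) / (b : ℤ)) *
        sawtooth (((a : ℤ) : ℝ) * k / (b : ℤ))
      = ∑ k ∈ Finset.range b, sawtooth ((k : ℝ) / b) * sawtooth ((a * k : ℕ) / b) := by
    obtain ⟨c, rfl⟩ : ∃ c, b = c + 1 := ⟨b - 1, by omega⟩
    rw [Finset.sum_range_succ']
    have h0 : sawtooth (((0 : ℕ) : ℝ) / (c + 1 : ℕ)) = 0 := by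
      simpa using sawtooth_intCast 0
    rw [h0, zero_mul, add_zero]
    have hI : Finset.Icc (1 : ℤ) ((c + 1 : ℕ) : ℤ)
        = (Finset.range (c + 1)).image (fun k : ℕ => ((k + 1 : ℕ) : ℤ)) := by
      ext x
      simp only [Finset.mem_Icc, Finset.mem_image, Finset.mem_range]
      constructor
      · intro hx
        exact ⟨(x - 1).toNat, by omega, by omega⟩
      · rintro ⟨k, hk, rfl⟩
        omega
    rw [hI, Finset.sum_image (by intro x _ y _ h; simpa using h), Finset.sum_range_succ]
    have h2 : sawtooth (((((c + 1 : ℕ) : ℤ) : ℝ)) / ((c + 1 : ℕ) : ℤ)) = 0 := by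
      rw [div_self (by exact_mod_cast hb')]
      simpa using sawtooth_intCast 1
    rw [h2, zero_mul, add_zero]
    refine Finset.sum_congr rfl fun k _ => ?_
    push_cast
    rfl
  -- At `k = 0` the right-hand product is `1/4`, whereas the sawtooth product is `0`; hence the `-
  -- 1/4`.
  have h3 : ∑ k ∈ Finset.range b, sawtooth ((k : ℝ) / b) * sawtooth ((a * k : ℕ) / b)
      = ∑ k ∈ Finset.range b, ((k : ℝ) / b - 1 / 2) * (((a * k % b : ℕ) : ℝ) / b - 1 / 2)
        - 1 / 4 := by
    obtain ⟨c, rfl⟩ : ∃ c, b = c + 1 := ⟨b - 1, by omega⟩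
    rw [Finset.sum_range_succ', Finset.sum_range_succ']
    have h0 : sawtooth (((0 : ℕ) : ℝ) / (c + 1 : ℕ)) = 0 := by
      simpa using sawtooth_intCast 0
    rw [h0]
    have : ∀ k ∈ Finset.range c, sawtooth (((k + 1 : ℕ) : ℝ) / (c + 1 : ℕ)) *
        sawtooth ((a * (k + 1) : ℕ) / (c + 1 : ℕ)) =
        (((k + 1 : ℕ) : ℝ) / (c + 1 : ℕ) - 1 / 2) *
          (((a * (k + 1) % (c + 1) : ℕ) : ℝ) / (c + 1 : ℕ) - 1 / 2) := by
      intro k hk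
      have hk' := Finset.mem_range.1 hk
      have e1 : (k + 1) % (c + 1) = k + 1 := Nat.mod_eq_of_lt (by omega)
      rw [sawtooth_natCast_div (by omega) hb, e1, sawtooth_natCast_div _ hb]
      intro h
      have := (Nat.Coprime.dvd_mul_left hab.symm).1 (Nat.dvd_of_mod_eq_zero h)
      exact absurd (Nat.le_of_dvd (by omega) this) (by omega)
    rw [Finset.sum_congr rfl this]
    norm_num
  have h4 : ∑ k ∈ Finset.range b, ((k : ℝ) / b - 1 / 2) * (((a * k % b : ℕ) : ℝ) / b - 1 / 2)
      = (∑ k ∈ Finset.range b, (k : ℝ) * ((a * k % b : ℕ) : ℝ)) / (b : ℝ) ^ 2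
        - (∑ k ∈ Finset.range b, (k : ℝ)) / (2 * b)
        - (∑ k ∈ Finset.range b, ((a * k % b : ℕ) : ℝ)) / (2 * b) + b / 4 := by
    have e : (b : ℝ) / 4 = ∑ k ∈ Finset.range b, (1 / 4 : ℝ) := by simp; ring
    rw [e, Finset.sum_div, Finset.sum_div, Finset.sum_div, ← Finset.sum_sub_distrib,
      ← Finset.sum_sub_distrib, ← Finset.sum_add_distrib]
    refine Finset.sum_congr rfl fun k _ => ?_
    field_simp
    ring
  rw [dedekindS, h1, h3, h4, sum_mul_mod_eq hab (fun k => (k : ℝ)), sum_range_cast]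
  field_simp
  ring

/-- A square is a sum of odd numbers, so the left side is a weighted count of lattice points under a
line of slope `a/b`. Exchanging the summations counts the same points by rows, with floors of `b * j
/ a`. -/
theorem sum_floor_sq {a b : ℕ} (ha : 0 < a) (hb : 0 < b) (hab : a.Coprime b) :
    ∑ k ∈ Finset.range b, ((a * k / b : ℕ) : ℝ) ^ 2
      = ((b : ℝ) - 1) * (a - 1) ^ 2 - 2 * ∑ j ∈ Finset.range a, (j : ℝ) * ((b * j / a : ℕ) : ℝ)
        + ∑ j ∈ Finset.range a, ((b * j / a : ℕ) : ℝ) := by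
  -- The summand `1` cancels the term `2 * 0 - 1` of `j = 0`.
  have hsq : ∀ k ∈ Finset.range b, ((a * k / b : ℕ) : ℝ) ^ 2
      = 1 + ∑ j ∈ Finset.range a, if j * b ≤ a * k then (2 * (j : ℝ) - 1) else 0 := by
    intro k hk
    have hk' := Finset.mem_range.1 hk
    rw [← Finset.sum_filter]
    have hf : (Finset.range a).filter (fun j => j * b ≤ a * k) = Finset.range (a * k / b + 1) := by
      ext j
      simp only [Finset.mem_filter, Finset.mem_range, Nat.lt_succ_iff, Nat.le_div_iff_mul_le hb]
      refine ⟨fun h => h.2, fun h => ⟨?_, h⟩⟩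
      by_contra hj
      have : a * b ≤ j * b := Nat.mul_le_mul_right b (by omega)
      have : a * k < a * b := Nat.mul_lt_mul_of_pos_left hk' ha
      omega
    rw [hf, Finset.sum_sub_distrib, ← Finset.mul_sum, sum_range_cast]
    simp
    ring
  have hcnt : ∀ j ∈ Finset.range a, ∑ k ∈ Finset.range b, (if j * b ≤ a * k then
      (2 * (j : ℝ) - 1) else 0) = (2 * (j : ℝ) - 1) * (b - 1 - ((b * j / a : ℕ) : ℝ))
        + if j = 0 then -1 else 0 := by
    intro j hj
    have hj' := Finset.mem_range.1 hj
    by_cases h0 : j = 0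
    · subst h0
      simp
      ring
    · have e : ∀ k ∈ Finset.range b, (if j * b ≤ a * k then (2 * (j : ℝ) - 1) else 0)
          = (2 * (j : ℝ) - 1) - if a * k < j * b then (2 * (j : ℝ) - 1) else 0 := by
        intro k _
        by_cases h : j * b ≤ a * k
        · simp [h, not_lt.2 h]
        · simp [h, not_le.1 h]
      have hf : (Finset.range b).filter (fun k => a * k < j * b)
          = Finset.range (b * j / a + 1) := by
        ext k
        simp only [Finset.mem_filter, Finset.mem_range, Nat.lt_succ_iff, Nat.le_div_iff_mul_le ha]
        constructor
        · rintro ⟨_, h⟩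
          nlinarith
        · intro h
          have hne : k * a ≠ b * j := by
            intro h'
            have : a ∣ b * j := ⟨k, by rw [← h', mul_comm]⟩
            have := (Nat.Coprime.dvd_mul_left hab).1 this
            exact absurd (Nat.le_of_dvd (by omega) this) (by omega)
          have hlt : a * k < j * b := by
            have := lt_of_le_of_ne h hne
            nlinarith
          refine ⟨?_, hlt⟩
          by_contra hk
          have : a * b ≤ a * k := Nat.mul_le_mul_left a (by omega)
          have : j * b < a * b := Nat.mul_lt_mul_of_pos_right hj' hb
          omega
      rw [Finset.sum_congr rfl e, Finset.sum_sub_distrib, ← Finset.sum_filter, hf]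
      simp [h0]
      ring
  rw [Finset.sum_congr rfl hsq, Finset.sum_add_distrib, Finset.sum_comm,
    Finset.sum_congr rfl hcnt, Finset.sum_add_distrib]
  have e1 : ∑ j ∈ Finset.range a, (if j = 0 then (-1 : ℝ) else 0) = -1 := by
    rw [Finset.sum_ite_eq' (Finset.range a) 0]
    simp [ha]
  have e2 : ∑ j ∈ Finset.range a, (2 * (j : ℝ) - 1) * ((b : ℝ) - 1 - ((b * j / a : ℕ) : ℝ))
      = (b - 1) * (2 * (∑ j ∈ Finset.range a, (j : ℝ)) - a)
        - 2 * ∑ j ∈ Finset.range a, (j : ℝ) * ((b * j / a : ℕ) : ℝ)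
        + ∑ j ∈ Finset.range a, ((b * j / a : ℕ) : ℝ) := by
    have e : (a : ℝ) = ∑ j ∈ Finset.range a, (1 : ℝ) := by simp
    conv_rhs => rw [e]
    rw [Finset.mul_sum, ← Finset.sum_sub_distrib, Finset.mul_sum, Finset.mul_sum,
      ← Finset.sum_sub_distrib, ← Finset.sum_add_distrib]
    refine Finset.sum_congr rfl fun k _ => ?_
    ring
  rw [e1, e2, sum_range_cast]
  simp
  ring

theorem cast_mul_mod (a k b : ℕ) :
    ((a * k % b : ℕ) : ℝ) = a * k - b * ((a * k / b : ℕ) : ℝ) := by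
  have : ((a * k % b : ℕ) : ℝ) + b * ((a * k / b : ℕ) : ℝ) = a * k := by
    exact_mod_cast Nat.mod_add_div (a * k) b
  linarith

/-- Multiplication by a unit permutes the residues. Comparing sums of residues gives `W`; comparing
sums of their squares, with `sum_floor_sq`, gives a linear relation between the mixed sums `X` and
`Y` that make up the two Dedekind sums. -/
theorem dedekindS_reciprocity_nat {a b : ℕ} (ha : 0 < a) (hb : 0 < b) (hab : a.Coprime b) :
    dedekindS a b + dedekindS b a = -3 + (a : ℝ) / b + b / a + 1 / (a * b) := by
  have ha' : (a : ℝ) ≠ 0 := by exact_mod_cast ha.ne'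
  have hb' : (b : ℝ) ≠ 0 := by exact_mod_cast hb.ne'
  have hx : ∀ a b : ℕ, ∑ k ∈ Finset.range b, (k : ℝ) * ((a * k % b : ℕ) : ℝ)
      = a * (∑ k ∈ Finset.range b, (k : ℝ) ^ 2)
        - b * ∑ k ∈ Finset.range b, (k : ℝ) * ((a * k / b : ℕ) : ℝ) := by
    intro a b
    rw [Finset.mul_sum, Finset.mul_sum, ← Finset.sum_sub_distrib]
    refine Finset.sum_congr rfl fun k _ => ?_
    rw [cast_mul_mod]
    ring
  have hlin : ∑ j ∈ Finset.range a, (j : ℝ)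
      = b * (∑ j ∈ Finset.range a, (j : ℝ)) - a * ∑ j ∈ Finset.range a, ((b * j / a : ℕ) : ℝ) := by
    conv_lhs => rw [← sum_mul_mod_eq hab.symm (fun k => (k : ℝ))]
    rw [Finset.mul_sum, Finset.mul_sum, ← Finset.sum_sub_distrib]
    exact Finset.sum_congr rfl fun k _ => cast_mul_mod _ _ _
  have hquad : ∑ k ∈ Finset.range b, (k : ℝ) ^ 2
      = a ^ 2 * (∑ k ∈ Finset.range b, (k : ℝ) ^ 2)
        - 2 * a * b * (∑ k ∈ Finset.range b, (k : ℝ) * ((a * k / b : ℕ) : ℝ))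
        + b ^ 2 * ∑ k ∈ Finset.range b, ((a * k / b : ℕ) : ℝ) ^ 2 := by
    conv_lhs => rw [← sum_mul_mod_eq hab (fun k => (k : ℝ) ^ 2)]
    rw [Finset.mul_sum, Finset.mul_sum, Finset.mul_sum, ← Finset.sum_sub_distrib,
      ← Finset.sum_add_distrib]
    refine Finset.sum_congr rfl fun k _ => ?_
    rw [cast_mul_mod]
    ring
  rw [sum_floor_sq ha hb hab] at hquad
  rw [dedekindS_natCast hb hab, dedekindS_natCast ha hab.symm, hx a b, hx b a]
  simp only [sum_range_cast, sum_range_cast_sq] at *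
  generalize ∑ k ∈ Finset.range b, (k : ℝ) * ((a * k / b : ℕ) : ℝ) = X at *
  generalize ∑ k ∈ Finset.range a, (k : ℝ) * ((b * k / a : ℕ) : ℝ) = Y at *
  generalize ∑ k ∈ Finset.range a, ((b * k / a : ℕ) : ℝ) = W at *
  have hW : W = (a - 1) * (b - 1) / 2 := by
    field_simp
    have : (a : ℝ) * (W * 2 - (a - 1) * (b - 1)) = 0 := by linarith
    rcases mul_eq_zero.1 this with h | h
    · exact absurd h ha'
    · linarith
  subst hW
  have hY : Y = (a ^ 2 * (b * (b - 1) * (2 * b - 1) / 6) - b * (b - 1) * (2 * b - 1) / 6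
      - 2 * a * b * X + b ^ 2 * ((b - 1) * (a - 1) ^ 2 + (a - 1) * (b - 1) / 2))
        / (2 * b ^ 2) := by
    rw [eq_div_iff (by positivity)]
    linarith
  rw [hY]
  field_simp
  ring

theorem dedekindS_reciprocity {a b : ℤ} (ha : 0 < a) (hb : 0 < b) (hab : IsCoprime a b) :
    dedekindS a b + dedekindS b a = -3 + (a : ℝ) / b + b / a + 1 / (a * b) := by
  lift a to ℕ using ha.le
  lift b to ℕ using hb.le
  simpa using dedekindS_reciprocity_nat (by exact_mod_cast ha) (by exact_mod_cast hb)
    (Nat.isCoprime_iff_coprime.1 hab)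

/-! ### Continued fractions of both kinds, with sign `ε = ±1` -/

/-- Numerators of the convergents of `a 0 + ε / (a 1 + ε / (a 2 + ⋯))`. -/
def cfNum (ε : ℤ) (a : ℕ → ℤ) : ℕ → ℤ
  | 0 => a 0
  | 1 => a 1 * a 0 + ε
  | k + 2 => a (k + 2) * cfNum ε a (k + 1) + ε * cfNum ε a k

/-- Denominators of the convergents of `a 0 + ε / (a 1 + ε / (a 2 + ⋯))`. -/
def cfDen (ε : ℤ) (a : ℕ → ℤ) : ℕ → ℤ
  | 0 => 1
  | 1 => a 1
  | k + 2 => a (k + 2) * cfDen ε a (k + 1) + ε * cfDen ε a k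

/-- The convergents of `a 0 + ε / (a 1 + ε / (a 2 + ⋯))`. -/
noncomputable def cfConv (ε : ℤ) (a : ℕ → ℤ) (k : ℕ) : ℝ := (cfNum ε a k : ℝ) / cfDen ε a k

theorem regNum_eq_cfNum (a : ℕ → ℤ) : ∀ k, regNum a k = cfNum 1 a k
  | 0 => rfl
  | 1 => rfl
  | k + 2 => by rw [regNum, cfNum, regNum_eq_cfNum a (k + 1), regNum_eq_cfNum a k, one_mul]

theorem regDen_eq_cfDen (a : ℕ → ℤ) : ∀ k, regDen a k = cfDen 1 a k
  | 0 => rfl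
  | 1 => rfl
  | k + 2 => by rw [regDen, cfDen, regDen_eq_cfDen a (k + 1), regDen_eq_cfDen a k, one_mul]

theorem negNum_eq_cfNum (a : ℕ → ℤ) : ∀ k, negNum a k = cfNum (-1) a k
  | 0 => rfl
  | 1 => rfl
  | k + 2 => by rw [negNum, cfNum, negNum_eq_cfNum a (k + 1), negNum_eq_cfNum a k]; ring

theorem negDen_eq_cfDen (a : ℕ → ℤ) : ∀ k, negDen a k = cfDen (-1) a k
  | 0 => rfl
  | 1 => rfl
  | k + 2 => by rw [negDen, cfDen, negDen_eq_cfDen a (k + 1), negDen_eq_cfDen a k]; ring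

/-- This and `cfNum_succ` peel off the first digit; inductions through reciprocity proceed from that
end. -/
theorem cfDen_succ (ε : ℤ) (a : ℕ → ℤ) : ∀ k, cfDen ε a (k + 1) = cfNum ε (fun n => a (n + 1)) k
  | 0 => rfl
  | 1 => by simp [cfDen, cfNum]
  | k + 2 => by
    rw [cfDen, cfNum, cfDen_succ ε a (k + 1), cfDen_succ ε a k]

theorem cfNum_succ (ε : ℤ) (a : ℕ → ℤ) : ∀ k, cfNum ε a (k + 1)
    = a 0 * cfNum ε (fun n => a (n + 1)) k + ε * cfDen ε (fun n => a (n + 1)) k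
  | 0 => by simp only [cfNum, cfDen]; ring
  | 1 => by simp only [cfNum, cfDen]; ring
  | k + 2 => by
    rw [cfNum, cfNum_succ ε a (k + 1), cfNum_succ ε a k, cfNum, cfDen]
    ring

theorem cfNum_mul_cfDen_sub (ε : ℤ) (a : ℕ → ℤ) (k : ℕ) :
    cfNum ε a (k + 1) * cfDen ε a k - cfNum ε a k * cfDen ε a (k + 1) = ε * (-ε) ^ k := by
  induction k with
  | zero => simp only [cfNum, cfDen]; ring
  | succ k ih =>
    rw [cfNum, cfDen, pow_succ, ← mul_assoc, ← ih]
    ring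

/-- The partial quotients `a 1, a 2, …` are those of a regular (`ε = 1`) or negative regular
(`ε = -1`) continued fraction. -/
def CFAdmissible (ε : ℤ) (a : ℕ → ℤ) : Prop :=
  (ε = 1 ∧ ∀ j, 1 ≤ a (j + 1)) ∨ (ε = -1 ∧ ∀ j, 2 ≤ a (j + 1))

theorem CFAdmissible.isUnit {ε : ℤ} {a : ℕ → ℤ} (h : CFAdmissible ε a) : ε = 1 ∨ ε = -1 :=
  h.imp And.left And.left

theorem CFAdmissible.shift {ε : ℤ} {a : ℕ → ℤ} (h : CFAdmissible ε a) (i : ℕ) :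
    CFAdmissible ε (fun n => a (n + i)) := by
  rcases h with ⟨h, h'⟩ | ⟨h, h'⟩
  · exact Or.inl ⟨h, fun j => by simpa [add_right_comm] using h' (j + i)⟩
  · exact Or.inr ⟨h, fun j => by simpa [add_right_comm] using h' (j + i)⟩

/-- Linear growth is all that both kinds share: if all negative digits are `2`, the denominators are
`k + 1`. The factor `2` makes room for regular digits `1`. -/
theorem CFAdmissible.den_bounds {ε : ℤ} {a : ℕ → ℤ} (h : CFAdmissible ε a) (k : ℕ) :
    (k : ℤ) + 1 ≤ 2 * cfDen ε a k ∧ (k : ℤ) + 2 ≤ 2 * cfDen ε a (k + 1) ∧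
      1 ≤ cfDen ε a (k + 1) + ε * cfDen ε a k := by
  rcases h with ⟨rfl, h⟩ | ⟨rfl, h⟩
  · have key : (k : ℤ) + 1 ≤ 2 * cfDen 1 a k ∧ (k : ℤ) + 2 ≤ 2 * cfDen 1 a (k + 1) := by
      induction k with
      | zero => simpa [cfDen] using (by linarith [h 0] : 2 ≤ 2 * a 1)
      | succ k ih =>
        refine ⟨by push_cast; linarith [ih.2], ?_⟩
        rw [cfDen]
        push_cast
        nlinarith [h (k + 1), ih.1, ih.2]
    exact ⟨key.1, key.2, by linarith⟩
  · have key : (k : ℤ) + 1 ≤ cfDen (-1) a k ∧ cfDen (-1) a k + 1 ≤ cfDen (-1) a (k + 1) := by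
      induction k with
      | zero => simpa [cfDen] using h 0
      | succ k ih =>
        refine ⟨by push_cast; linarith [ih.1, ih.2], ?_⟩
        rw [cfDen]
        nlinarith [h (k + 1), ih.1, ih.2]
    refine ⟨?_, ?_, ?_⟩ <;> linarith

theorem CFAdmissible.le_two_mul_cfDen {ε : ℤ} {a : ℕ → ℤ} (h : CFAdmissible ε a) (k : ℕ) :
    (k : ℤ) + 1 ≤ 2 * cfDen ε a k := (h.den_bounds k).1

theorem CFAdmissible.cfDen_pos {ε : ℤ} {a : ℕ → ℤ} (h : CFAdmissible ε a) (k : ℕ) :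
    0 < cfDen ε a k := by
  have := h.le_two_mul_cfDen k
  omega

/-- Only finitely many relations are required, so `y` may be complete quotients, values of tails,
finite convergents, or quotients of denominators. All four occur below. -/
theorem cf_tail_identity {ε : ℤ} {a : ℕ → ℤ} {y : ℕ → ℝ} {n : ℕ}
    (hy : ∀ j ≤ n + 1, y j = a j + ε / y (j + 1)) (hy0 : ∀ j ≤ n + 1, y (j + 1) ≠ 0) :
    y 0 * (cfDen ε a (n + 1) * y (n + 2) + ε * cfDen ε a n)
      = cfNum ε a (n + 1) * y (n + 2) + ε * cfNum ε a n := by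
  induction n with
  | zero =>
    have h1 := hy0 0 (by omega)
    have h2 := hy0 1 (by omega)
    have e0 := hy 0 (by omega)
    have e1 := hy 1 (by omega)
    simp only [zero_add, Nat.reduceAdd] at *
    have e0' : y 0 * y 1 = a 0 * y 1 + ε := by rw [e0]; field_simp
    have e1' : y 1 * y 2 = a 1 * y 2 + ε := by rw [e1]; field_simp
    simp only [cfNum, cfDen]
    push_cast
    linear_combination y 2 * e0' + (a 0 - y 0) * e1'
  | succ n ih =>
    have := ih (fun j hj => hy j (by omega)) (fun j hj => hy0 j (by omega))
    have h2 := hy0 (n + 2) (by omega)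
    have e := hy (n + 2) (by omega)
    have e' : y (n + 2) * y (n + 3) = a (n + 2) * y (n + 3) + ε := by rw [e]; field_simp
    simp only [cfNum, cfDen, show n + 1 + 2 = n + 3 from rfl, show n + 1 + 1 = n + 2 from rfl] at *
    push_cast
    linear_combination y (n + 3) * this - (y 0 * cfDen ε a (n + 1) - cfNum ε a (n + 1)) * e'

theorem CFAdmissible.abs_det {ε : ℤ} {a : ℕ → ℤ} (h : CFAdmissible ε a) (k : ℕ) :
    |(cfNum ε a (k + 1) : ℝ) * cfDen ε a k - cfNum ε a k * cfDen ε a (k + 1)| = 1 := by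
  have := cfNum_mul_cfDen_sub ε a k
  have h1 : |ε * (-ε) ^ k| = 1 := by
    rcases h.isUnit with rfl | rfl <;> simp [abs_pow]
  rw [← this] at h1
  exact_mod_cast h1

theorem CFAdmissible.tail_den_ge_one {ε : ℤ} {a : ℕ → ℤ} (h : CFAdmissible ε a) (n : ℕ) {y : ℝ}
    (hy : 1 ≤ y) : 1 ≤ (cfDen ε a (n + 1) : ℝ) * y + ε * cfDen ε a n := by
  have h1 : (1 : ℝ) ≤ (cfDen ε a (n + 1) : ℝ) + ε * cfDen ε a n := by
    exact_mod_cast (h.den_bounds n).2.2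
  have h2 : (0 : ℝ) < cfDen ε a (n + 1) := by exact_mod_cast h.cfDen_pos (n + 1)
  nlinarith

/-- The tail identity and the determinant `±1` give the approximation error exactly. The equality,
not just the bound, serves in `irrational_value_one`. -/
theorem CFAdmissible.abs_tail {ε : ℤ} {a : ℕ → ℤ} (h : CFAdmissible ε a) {y : ℕ → ℝ} {n : ℕ}
    (hy : ∀ j ≤ n + 1, y j = a j + ε / y (j + 1)) (hy1 : ∀ j ≤ n + 1, 1 ≤ y (j + 1)) :
    |y 0 * cfDen ε a (n + 1) - cfNum ε a (n + 1)|
      * (cfDen ε a (n + 1) * y (n + 2) + ε * cfDen ε a n) = 1 := by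
  have hid := cf_tail_identity hy fun j hj => by linarith [hy1 j hj]
  have hge := h.tail_den_ge_one n (hy1 (n + 1) le_rfl)
  have e : |(y 0 * cfDen ε a (n + 1) - cfNum ε a (n + 1))
      * (cfDen ε a (n + 1) * y (n + 2) + ε * cfDen ε a n)|
      = |(ε : ℝ)| * |(cfNum ε a (n + 1) : ℝ) * cfDen ε a n - cfNum ε a n * cfDen ε a (n + 1)| := by
    rw [← abs_neg, ← abs_mul]
    congr 1
    linear_combination (-(cfDen ε a (n + 1) : ℝ)) * hid
  rw [h.abs_det, mul_one] at e
  rw [abs_mul, abs_of_pos (by linarith : 0 < (cfDen ε a (n + 1) : ℝ) * y (n + 2) + _)] at e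
  rw [show n + 2 = n + 1 + 1 from rfl] at *
  rw [e]
  rcases h.isUnit with rfl | rfl <;> simp

theorem CFAdmissible.abs_sub_conv_le {ε : ℤ} {a : ℕ → ℤ} (h : CFAdmissible ε a) {y : ℕ → ℝ} {n : ℕ}
    (hy : ∀ j ≤ n + 1, y j = a j + ε / y (j + 1)) (hy1 : ∀ j ≤ n + 1, 1 ≤ y (j + 1)) :
    |y 0 - cfConv ε a (n + 1)| ≤ 2 / (n + 2) := by
  have hpos : (0 : ℝ) < cfDen ε a (n + 1) := by exact_mod_cast h.cfDen_pos (n + 1)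
  have hge := h.tail_den_ge_one n (hy1 (n + 1) le_rfl)
  have hab := h.abs_tail hy hy1
  have hden : (n : ℝ) + 2 ≤ 2 * cfDen ε a (n + 1) := by exact_mod_cast (h.den_bounds n).2.1
  have h1 : |y 0 * cfDen ε a (n + 1) - cfNum ε a (n + 1)| ≤ 1 := by
    nlinarith [abs_nonneg (y 0 * cfDen ε a (n + 1) - cfNum ε a (n + 1))]
  have e : y 0 - cfConv ε a (n + 1)
      = (y 0 * cfDen ε a (n + 1) - cfNum ε a (n + 1)) / cfDen ε a (n + 1) := by
    rw [cfConv]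
    field_simp
  rw [e, abs_div, abs_of_pos hpos, div_le_div_iff₀ hpos (by positivity)]
  nlinarith

/-! ### Convergence and values -/

/-- All partial quotients, including `a 0`, are admissible. -/
def CFAdmissible' (ε : ℤ) (a : ℕ → ℤ) : Prop :=
  (ε = 1 ∧ ∀ j, 1 ≤ a j) ∨ (ε = -1 ∧ ∀ j, 2 ≤ a j)

theorem CFAdmissible'.admissible {ε : ℤ} {a : ℕ → ℤ} (h : CFAdmissible' ε a) : CFAdmissible ε a :=
  h.imp (fun h => ⟨h.1, fun _ => h.2 _⟩) fun h => ⟨h.1, fun _ => h.2 _⟩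

theorem CFAdmissible'.shift {ε : ℤ} {a : ℕ → ℤ} (h : CFAdmissible' ε a) (i : ℕ) :
    CFAdmissible' ε (fun n => a (n + i)) :=
  h.imp (fun h => ⟨h.1, fun _ => h.2 _⟩) fun h => ⟨h.1, fun _ => h.2 _⟩

theorem CFAdmissible.tail {ε : ℤ} {a : ℕ → ℤ} (h : CFAdmissible ε a) :
    CFAdmissible' ε (fun n => a (n + 1)) := h

theorem CFAdmissible'.cfDen_le_cfNum {ε : ℤ} {a : ℕ → ℤ} (h : CFAdmissible' ε a) (k : ℕ) :
    cfDen ε a k ≤ cfNum ε a k := by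
  induction k generalizing a with
  | zero => rcases h with h | h <;> simp only [cfNum, cfDen] <;> linarith [h.2 0]
  | succ k ih =>
    have h1 := ih (h.shift 1)
    have h2 := (h.shift 1).admissible.cfDen_pos k
    rw [cfNum_succ, cfDen_succ]
    rcases h with ⟨rfl, h⟩ | ⟨rfl, h⟩ <;> nlinarith [h 0]

theorem CFAdmissible'.one_le_conv {ε : ℤ} {a : ℕ → ℤ} (h : CFAdmissible' ε a) (k : ℕ) :
    1 ≤ cfConv ε a k := by
  have h2 : (0 : ℝ) < cfDen ε a k := by exact_mod_cast h.admissible.cfDen_pos k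
  rw [cfConv, le_div_iff₀ h2, one_mul]
  exact_mod_cast h.cfDen_le_cfNum k

theorem CFAdmissible.conv_succ {ε : ℤ} {a : ℕ → ℤ} (h : CFAdmissible ε a) (k : ℕ) :
    cfConv ε a (k + 1) = a 0 + ε / cfConv ε (fun n => a (n + 1)) k := by
  have h1 : (cfNum ε (fun n => a (n + 1)) k : ℝ) ≠ 0 := by
    have := h.tail.cfDen_le_cfNum k
    have := h.tail.admissible.cfDen_pos k
    exact_mod_cast (by linarith : (0 : ℤ) < _).ne'
  rw [cfConv, cfConv, cfNum_succ, cfDen_succ]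
  push_cast
  field_simp

theorem CFAdmissible.abs_conv_sub_conv_le {ε : ℤ} {a : ℕ → ℤ} (h : CFAdmissible ε a) {n k : ℕ}
    (hnk : n + 2 ≤ k) : |cfConv ε a k - cfConv ε a (n + 1)| ≤ 2 / (n + 2) := by
  -- The convergents of the shifted sequences play the part of complete quotients of the finite
  -- fraction `cfConv ε a k`.
  have key := h.abs_sub_conv_le (n := n) (y := fun j => cfConv ε (fun i => a (i + j)) (k - j))
  refine key (fun j hj => ?_) fun j hj => ?_
  · obtain ⟨i, hi⟩ : ∃ i, k - j = i + 1 := ⟨k - j - 1, by omega⟩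
    have hi' : k - (j + 1) = i := by omega
    simp only [hi, hi']
    rw [(h.shift j).conv_succ]
    simp only [zero_add, add_assoc, add_comm 1 j]
  · have := (h.tail.shift j).one_le_conv (k - (j + 1))
    simpa [add_assoc, add_comm 1 j] using this

theorem tendsto_div_natCast_add_two (C : ℝ) : Tendsto (fun n : ℕ => C / ((n : ℝ) + 2)) atTop (𝓝 0) :=
  Tendsto.div_atTop tendsto_const_nhds
    (tendsto_atTop_add_const_right _ _ tendsto_natCast_atTop_atTop)

theorem CFAdmissible.exists_tendsto {ε : ℤ} {a : ℕ → ℤ} (h : CFAdmissible ε a) :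
    ∃ x, Tendsto (cfConv ε a) atTop (𝓝 x) := by
  refine cauchySeq_tendsto_of_complete ?_
  rw [← cauchySeq_shift 1]
  refine cauchySeq_of_le_tendsto_0 (fun n : ℕ => 4 / ((n : ℝ) + 2)) (fun n m N hn hm => ?_)
    (tendsto_div_natCast_add_two 4)
  have aux : ∀ n, N ≤ n → |cfConv ε a (n + 1) - cfConv ε a (N + 1)| ≤ 2 / (N + 2) := by
    intro n hn
    rcases hn.eq_or_lt with rfl | hlt
    · simp only [sub_self, abs_zero]
      positivity
    · exact h.abs_conv_sub_conv_le (by omega)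
  calc dist (cfConv ε a (n + 1)) (cfConv ε a (m + 1))
      ≤ dist (cfConv ε a (n + 1)) (cfConv ε a (N + 1))
        + dist (cfConv ε a (m + 1)) (cfConv ε a (N + 1)) := dist_triangle_right _ _ _
    _ ≤ 2 / (N + 2) + 2 / (N + 2) := add_le_add (aux n hn) (aux m hm)
    _ = 4 / (N + 2) := by ring

/-- The value of an infinite continued fraction. -/
noncomputable def cfValue (ε : ℤ) (a : ℕ → ℤ) : ℝ := limUnder atTop (cfConv ε a)

theorem regValue_eq_cfValue (a : ℕ → ℤ) : regValue a = cfValue 1 a := by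
  simp only [regValue, cfValue, regNum_eq_cfNum, regDen_eq_cfDen]
  rfl

theorem negValue_eq_cfValue (a : ℕ → ℤ) : negValue a = cfValue (-1) a := by
  simp only [negValue, cfValue, negNum_eq_cfNum, negDen_eq_cfDen]
  rfl

theorem CFAdmissible.tendsto_value {ε : ℤ} {a : ℕ → ℤ} (h : CFAdmissible ε a) :
    Tendsto (cfConv ε a) atTop (𝓝 (cfValue ε a)) :=
  tendsto_nhds_limUnder h.exists_tendsto

theorem CFAdmissible'.one_le_value {ε : ℤ} {a : ℕ → ℤ} (h : CFAdmissible' ε a) :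
    1 ≤ cfValue ε a :=
  ge_of_tendsto' h.admissible.tendsto_value h.one_le_conv

theorem CFAdmissible.value_eq {ε : ℤ} {a : ℕ → ℤ} (h : CFAdmissible ε a) :
    cfValue ε a = a 0 + ε / cfValue ε (fun n => a (n + 1)) := by
  have h1 := h.tail.one_le_value
  refine tendsto_nhds_unique ((tendsto_add_atTop_iff_nat 1).2 h.tendsto_value) ?_
  simp only [h.conv_succ]
  exact (tendsto_const_nhds.div h.tail.admissible.tendsto_value (by linarith)).const_add _

/-- A sequence of complete quotients determines the limit of the convergents. -/
theorem CFAdmissible.tendsto_of_quot {ε : ℤ} {a : ℕ → ℤ} (h : CFAdmissible ε a) {y : ℕ → ℝ}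
    (hy : ∀ j, y j = a j + ε / y (j + 1)) (hy1 : ∀ j, 1 ≤ y (j + 1)) :
    Tendsto (cfConv ε a) atTop (𝓝 (y 0)) := by
  rw [← tendsto_add_atTop_iff_nat 1, tendsto_iff_dist_tendsto_zero]
  refine squeeze_zero (fun _ => dist_nonneg) (fun n => ?_) (tendsto_div_natCast_add_two 2)
  rw [dist_comm]
  exact h.abs_sub_conv_le (fun j _ => hy j) fun j _ => hy1 j

theorem CFAdmissible'.tail_identity_value {ε : ℤ} {a : ℕ → ℤ} (h : CFAdmissible' ε a) (n : ℕ) :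
    cfValue ε a * (cfDen ε a (n + 1) * cfValue ε (fun i => a (i + (n + 2))) + ε * cfDen ε a n)
      = cfNum ε a (n + 1) * cfValue ε (fun i => a (i + (n + 2))) + ε * cfNum ε a n := by
  have := cf_tail_identity (ε := ε) (a := a) (y := fun j => cfValue ε (fun i => a (i + j)))
    (n := n) (fun j _ => ?_) fun j _ => ?_
  · simpa using this
  · have := (h.shift j).admissible.value_eq
    simpa [add_assoc, add_comm 1 j] using this
  · have := (h.shift (j + 1)).one_le_value
    exact (by linarith : (0 : ℝ) < _).ne'

/-! ### Irrationality, and separation of regular from negative values -/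

/-- For a rational value `r`, `A` is an integer with `|A| * W = r.den`; but `W` exceeds `r.den` for
large `n`, so `0 < |A| < 1`. -/
theorem irrational_value_one {a : ℕ → ℤ} (h : ∀ j, 1 ≤ a j) : Irrational (cfValue 1 a) := by
  have hA : CFAdmissible' 1 a := Or.inl ⟨rfl, h⟩
  rintro ⟨r, hr⟩
  obtain ⟨n, hn⟩ := exists_nat_gt (2 * (r.den : ℝ))
  have hval : ∀ j, 1 ≤ cfValue 1 (fun i => a (i + j)) := fun j => (hA.shift j).one_le_value
  have key := hA.admissible.abs_tail (y := fun j => cfValue 1 (fun i => a (i + j)))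
    (n := n) (fun j _ => by
      have := (hA.shift j).admissible.value_eq
      simpa [add_assoc, add_comm 1 j] using this) fun j _ => hval _
  have hD := (hA.admissible.den_bounds n)
  have hD0 := hA.admissible.cfDen_pos n
  have hden : (0 : ℝ) < r.den := by exact_mod_cast r.pos
  have hr' : (r : ℝ) * r.den = r.num := by exact_mod_cast Rat.mul_den_eq_num r
  simp only [add_zero, ← hr] at key
  set A : ℤ := r.num * cfDen 1 a (n + 1) - r.den * cfNum 1 a (n + 1) with hAdef
  have hAeq : (A : ℝ) = r.den * (r * cfDen 1 a (n + 1) - cfNum 1 a (n + 1)) := by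
    rw [hAdef]
    push_cast
    rw [← hr']
    ring
  set W : ℝ := cfDen 1 a (n + 1) * cfValue 1 (fun i => a (i + (n + 2))) + (1 : ℤ) * cfDen 1 a n
    with hW
  have hWge : (r.den : ℝ) < W := by
    have h1 : (n : ℝ) + 2 ≤ 2 * cfDen 1 a (n + 1) := by exact_mod_cast hD.2.1
    have h2 : (0 : ℝ) < cfDen 1 a n := by exact_mod_cast hD0
    have h3 := hval (n + 2)
    rw [hW]
    push_cast
    nlinarith
  have hAW : |(A : ℝ)| * W = r.den := by
    rw [hAeq, abs_mul, abs_of_pos hden, mul_assoc, key, mul_one]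
  have hA0 : A ≠ 0 := by
    intro h0
    rw [h0, Int.cast_zero, abs_zero, zero_mul] at hAW
    exact hden.ne hAW
  have hA1 : (1 : ℝ) ≤ |(A : ℝ)| := by exact_mod_cast Int.one_le_abs hA0
  nlinarith

/-- A purely periodic regular continued fraction of even period and a purely periodic negative
regular one have different values: the conjugate of the first is negative, that of the second
positive. -/
theorem value_one_ne_value_neg_one {e f : ℕ → ℤ} (he : ∀ j, 1 ≤ e j) (hf : ∀ j, 2 ≤ f j)
    {L m : ℕ} (hL : 2 ≤ L) (hm : 2 ≤ m) (hep : ∀ j, e (j + L) = e j) (hfp : ∀ j, f (j + m) = f j) :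
    cfValue 1 e ≠ cfValue (-1) f := by
  intro heq
  have hE : CFAdmissible' 1 e := Or.inl ⟨rfl, he⟩
  have hF : CFAdmissible' (-1) f := Or.inr ⟨rfl, hf⟩
  obtain ⟨n, rfl⟩ := Nat.exists_eq_add_of_le' hL
  obtain ⟨k, rfl⟩ := Nat.exists_eq_add_of_le' hm
  have h1 := hE.tail_identity_value n
  have h2 := hF.tail_identity_value k
  simp only [hep] at h1
  simp only [hfp] at h2
  rw [← heq] at h2
  have hirr := irrational_value_one he
  generalize cfValue 1 e = u at *
  have p1 := hE.admissible.cfDen_pos n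
  have p2 := hE.admissible.cfDen_pos (n + 1)
  have p3 := hE.cfDen_le_cfNum n
  have q1 := hF.admissible.cfDen_pos k
  have q2 := hF.admissible.cfDen_pos (k + 1)
  have q3 := hF.cfDen_le_cfNum k
  generalize cfDen 1 e n = D0 at *
  generalize cfDen 1 e (n + 1) = D1 at *
  generalize cfNum 1 e n = N0 at *
  generalize cfNum 1 e (n + 1) = N1 at *
  generalize cfDen (-1) f k = T0 at *
  generalize cfDen (-1) f (k + 1) = T1 at *
  generalize cfNum (-1) f k = S0 at *
  generalize cfNum (-1) f (k + 1) = S1 at *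
  -- Eliminating `u ^ 2` from the two quadratic equations of `u`. Their constant terms have opposite
  -- signs, so the right side is positive and `u` would be rational.
  have hlin : ((T1 * (D0 - N1) + D1 * (T0 + S1) : ℤ) : ℝ) * u = ((T1 * N0 + D1 * S0 : ℤ) : ℝ) := by
    push_cast at *
    linear_combination T1 * h1 - D1 * h2
  have hpos : 0 < T1 * N0 + D1 * S0 := by
    have : 0 < N0 := by linarith
    have : 0 < S0 := by linarith
    positivity
  have hne : T1 * (D0 - N1) + D1 * (T0 + S1) ≠ 0 := by
    intro h0
    rw [h0, Int.cast_zero, zero_mul] at hlin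
    exact hpos.ne (by exact_mod_cast hlin)
  refine (hirr.intCast_mul hne) ⟨((T1 * N0 + D1 * S0 : ℤ) : ℚ), ?_⟩
  rw [hlin]
  push_cast
  rfl

/-! ### Dedekind sums of convergents -/

theorem CFAdmissible.isCoprime {ε : ℤ} {a : ℕ → ℤ} (h : CFAdmissible ε a) (k : ℕ) :
    IsCoprime (cfNum ε a k) (cfDen ε a k) := by
  have h1 := cfNum_mul_cfDen_sub ε a k
  have h2 : (ε * (-ε) ^ k) * (ε * (-ε) ^ k) = 1 := by
    rw [← sq, mul_pow, ← pow_mul, mul_comm k 2, pow_mul, neg_sq]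
    rcases h.isUnit with rfl | rfl <;> simp
  refine ⟨-(ε * (-ε) ^ k) * cfDen ε a (k + 1), (ε * (-ε) ^ k) * cfNum ε a (k + 1), ?_⟩
  linear_combination (ε * (-ε) ^ k) * h1 + h2

/-- The Dedekind sums of consecutive stages of a continued fraction, by reciprocity. -/
theorem dedekindS_conv_succ {ε : ℤ} {a : ℕ → ℤ} (h : CFAdmissible ε a) (k : ℕ) :
    dedekindS (cfNum ε a (k + 1)) (cfDen ε a (k + 1))
      = ε * (-dedekindS (cfNum ε (fun n => a (n + 1)) k) (cfDen ε (fun n => a (n + 1)) k) - 3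
        + (cfNum ε (fun n => a (n + 1)) k : ℝ) / cfDen ε (fun n => a (n + 1)) k
        + (cfDen ε (fun n => a (n + 1)) k : ℝ) / cfNum ε (fun n => a (n + 1)) k
        + 1 / ((cfNum ε (fun n => a (n + 1)) k : ℝ) * cfDen ε (fun n => a (n + 1)) k)) := by
  have hq := h.tail.admissible.cfDen_pos k
  have hp : 0 < cfNum ε (fun n => a (n + 1)) k := hq.trans_le (h.tail.cfDen_le_cfNum k)
  have hrec := dedekindS_reciprocity hp hq (CFAdmissible.isCoprime h.tail.admissible k)
  rw [cfNum_succ, cfDen_succ, add_comm (a 0 * _), dedekindS_add_mul _ _ _ hp]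
  rcases h.isUnit with rfl | rfl
  · rw [one_mul]
    push_cast
    linarith
  · rw [neg_one_mul, dedekindS_neg]
    push_cast
    linarith

/-- The determinant identity divided by the denominators. Its last term cancels the `1 / (p q)` of
reciprocity, and the remaining ratio of numerators is a ratio of denominators of the sequence with
one more digit in front. -/
theorem cf_den_ratio {ε : ℤ} {a : ℕ → ℤ} (h : CFAdmissible' ε a) (k : ℕ) :
    (cfDen ε a k : ℝ) / cfDen ε a (k + 1) = (cfNum ε a k : ℝ) / cfNum ε a (k + 1)
      + ε * (-ε) ^ k / ((cfNum ε a (k + 1) : ℝ) * cfDen ε a (k + 1)) := by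
  have hq : (0 : ℝ) < cfDen ε a (k + 1) := by exact_mod_cast h.admissible.cfDen_pos (k + 1)
  have hp : (0 : ℝ) < cfNum ε a (k + 1) := by
    exact_mod_cast (h.admissible.cfDen_pos (k + 1)).trans_le (h.cfDen_le_cfNum (k + 1))
  have hdet : (cfNum ε a (k + 1) : ℝ) * cfDen ε a k - cfNum ε a k * cfDen ε a (k + 1)
    = ε * (-ε) ^ k := by exact_mod_cast cfNum_mul_cfDen_sub ε a k
  rw [← hdet]
  field_simp
  ring

theorem dedekindS_conv_one {ε : ℤ} {a : ℕ → ℤ} (h : CFAdmissible ε a) :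
    dedekindS (cfNum ε a 1) (cfDen ε a 1) = ε * (-3 + a 1 + 2 / a 1) := by
  rw [dedekindS_conv_succ h 0]
  simp only [cfNum, cfDen, dedekindS_one_right, zero_add]
  push_cast
  ring

/-- The Barkan–Hickerson–Knuth formula. -/
theorem dedekindS_regular {a : ℕ → ℤ} (h : CFAdmissible 1 a) (k : ℕ) :
    dedekindS (cfNum 1 a (k + 1)) (cfDen 1 a (k + 1))
      = (∑ j ∈ Finset.range (k + 2), (-1 : ℝ) ^ (j + 1) * a j)
        + (cfNum 1 a (k + 1) : ℝ) / cfDen 1 a (k + 1)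
        + (-1) ^ k * ((cfDen 1 a k : ℝ) / cfDen 1 a (k + 1)) - if Even k then 3 else 0 := by
  induction k generalizing a with
  | zero =>
    have h1 : (a 1 : ℝ) ≠ 0 := by exact_mod_cast (h.cfDen_pos 1).ne'
    rw [dedekindS_conv_one h]
    simp only [cfNum, cfDen, Finset.sum_range_succ, Finset.sum_range_zero]
    push_cast
    simp
    field_simp
    ring
  | succ k ih =>
    rw [dedekindS_conv_succ h (k + 1), ih h.tail.admissible, Finset.sum_range_succ' _ (k + 2),
      cf_den_ratio h.tail k, cfNum_succ 1 a (k + 1), cfDen_succ 1 a (k + 1), cfDen_succ 1 a k]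
    have hp : (cfNum 1 (fun n => a (n + 1)) (k + 1) : ℝ) ≠ 0 := by
      exact_mod_cast ((h.tail.admissible.cfDen_pos (k + 1)).trans_le
        (h.tail.cfDen_le_cfNum (k + 1))).ne'
    have e : ∑ j ∈ Finset.range (k + 2), (-1 : ℝ) ^ (j + 1 + 1) * a (j + 1)
        = -∑ j ∈ Finset.range (k + 2), (-1 : ℝ) ^ (j + 1) * a (j + 1) := by
      rw [← Finset.sum_neg_distrib]
      exact Finset.sum_congr rfl fun j _ => by ring
    rw [e]
    push_cast
    rw [add_div, mul_div_cancel_right₀ _ hp]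
    have hs : ((-1 : ℝ) ^ k) * (-1) ^ k = 1 := by rw [← mul_pow]; simp
    rcases Nat.even_or_odd k with hk | hk
    · simp [hk, Nat.even_add_one]
      ring
    · have hk' : ¬ Even k := Nat.not_even_iff_odd.2 hk
      simp [hk', hk.neg_one_pow, Nat.even_add_one, pow_succ]
      ring

/-- For `ε = -1` the two sign changes per step cancel: the digits do not alternate, and every step
leaves a `3`. -/
theorem dedekindS_negative {a : ℕ → ℤ} (h : CFAdmissible (-1) a) (k : ℕ) :
    dedekindS (cfNum (-1) a (k + 1)) (cfDen (-1) a (k + 1))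
      = (∑ j ∈ Finset.range (k + 2), (3 - (a j : ℝ)))
        + (cfNum (-1) a (k + 1) : ℝ) / cfDen (-1) a (k + 1)
        - (cfDen (-1) a k : ℝ) / cfDen (-1) a (k + 1) - 3 := by
  induction k generalizing a with
  | zero =>
    have h1 : (a 1 : ℝ) ≠ 0 := by exact_mod_cast (h.cfDen_pos 1).ne'
    rw [dedekindS_conv_one h]
    simp only [cfNum, cfDen, Finset.sum_range_succ, Finset.sum_range_zero]
    push_cast
    field_simp
    ring
  | succ k ih =>
    rw [dedekindS_conv_succ h (k + 1), ih h.tail.admissible, Finset.sum_range_succ' _ (k + 2),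
      cf_den_ratio h.tail k, cfNum_succ (-1) a (k + 1), cfDen_succ (-1) a (k + 1),
      cfDen_succ (-1) a k]
    have hp : (cfNum (-1) (fun n => a (n + 1)) (k + 1) : ℝ) ≠ 0 := by
      exact_mod_cast ((h.tail.admissible.cfDen_pos (k + 1)).trans_le
        (h.tail.cfDen_le_cfNum (k + 1))).ne'
    push_cast
    rw [add_div, mul_div_cancel_right₀ _ hp]
    simp
    ring

/-! ### Quotients of consecutive denominators and the reversed period -/

theorem CFAdmissible.cfDen_le_succ {ε : ℤ} {a : ℕ → ℤ} (h : CFAdmissible ε a) (k : ℕ) :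
    cfDen ε a k ≤ cfDen ε a (k + 1) := by
  rw [cfDen_succ]
  induction k generalizing a with
  | zero => exact h.tail.admissible.cfDen_pos 0 |>.trans_le (h.tail.cfDen_le_cfNum 0)
  | succ k _ =>
    rcases h with ⟨rfl, h'⟩ | ⟨rfl, h'⟩
    · have hA : CFAdmissible 1 a := Or.inl ⟨rfl, h'⟩
      rw [← cfDen_succ, cfDen]
      nlinarith [hA.cfDen_pos k, hA.cfDen_pos (k + 1), h' (k + 1)]
    · have hA : CFAdmissible (-1) a := Or.inr ⟨rfl, h'⟩
      rw [← cfDen_succ]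
      linarith [(hA.den_bounds (k + 1)).2.2]

theorem periodic_add_mul {a : ℕ → ℤ} {N p : ℕ} (hper : ∀ n, N ≤ n → a (n + p) = a n) (t n : ℕ)
    (hn : N ≤ n) : a (n + t * p) = a n := by
  induction t with
  | zero => simp
  | succ t ih => rw [Nat.succ_mul, ← add_assoc, hper _ (by omega), ih]

/-- The bound on `j` keeps the index at least `N`, so that reading backwards never enters the
pre-period. -/
theorem reversedPeriod_apply {a : ℕ → ℤ} {N p h : ℕ} (hp : 1 ≤ p)
    (hper : ∀ n, N ≤ n → a (n + p) = a n) {t j : ℕ} (hj : j + 1 ≤ t * p + h) :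
    a (N + t * p + h - 1 - j) = reversedPeriod (periodEntry a N) p h j := by
  rw [reversedPeriod, periodEntry]
  set r := (((h : ℤ) - 1 - j) % (p : ℤ)).toNat with hr
  have hpz : (0 : ℤ) < p := by exact_mod_cast hp
  have hr' : (r : ℤ) = ((h : ℤ) - 1 - j) % (p : ℤ) := Int.toNat_of_nonneg (Int.emod_nonneg _ hpz.ne')
  have h1 : ((t * p + h - 1 - j : ℕ) : ℤ) % p = r := by
    rw [hr']
    have : ((t * p + h - 1 - j : ℕ) : ℤ) = ((h : ℤ) - 1 - j) + t * p := by
      have := hj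
      push_cast [Nat.sub_sub, show 1 + j ≤ t * p + h by omega]
      ring
    rw [this, Int.add_mul_emod_self_right]
  have h2 : (t * p + h - 1 - j) % p = r := by exact_mod_cast h1
  have h3 : N + t * p + h - 1 - j = N + r + (t * p + h - 1 - j) / p * p := by
    have := Nat.mod_add_div (t * p + h - 1 - j) p
    rw [h2, mul_comm] at this
    omega
  rw [h3, periodic_add_mul hper _ _ (by omega)]
  congr 1

theorem CFAdmissible.reversed {ε : ℤ} {a : ℕ → ℤ} (hA : CFAdmissible ε a) {N p h : ℕ}
    (hp : 1 ≤ p) (hper : ∀ n, N ≤ n → a (n + p) = a n) :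
    CFAdmissible' ε (reversedPeriod (periodEntry a N) p h) := by
  have key : ∀ j, ∃ i, reversedPeriod (periodEntry a N) p h j = a (i + 1) := by
    intro j
    refine ⟨N + (j + 2) * p + h - 1 - j - 1, ?_⟩
    have hle : j + 2 ≤ (j + 2) * p := Nat.le_mul_of_pos_right _ hp
    rw [← reversedPeriod_apply (t := j + 2) hp hper (by omega)]
    congr 1
    omega
  refine hA.imp (fun H => ⟨H.1, fun j => ?_⟩) fun H => ⟨H.1, fun j => ?_⟩ <;>
  · obtain ⟨i, hi⟩ := key j
    rw [hi]
    exact H.2 i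

theorem reversedPeriod_add (b : ℕ → ℤ) (p h j : ℕ) :
    reversedPeriod b p h (j + p) = reversedPeriod b p h j := by
  rw [reversedPeriod, reversedPeriod]
  have : (h : ℤ) - 1 - ((j + p : ℕ) : ℤ) = (h - 1 - j) - p := by push_cast; ring
  rw [this, Int.sub_emod_right]

/-- The recurrence reads `q_k / q_{k-1} = a_k + ε / (q_{k-1} / q_{k-2})`, so these quotients are
complete quotients for the digits read backwards. -/
theorem CFAdmissible.tendsto_den_ratio {ε : ℤ} {a : ℕ → ℤ} (hA : CFAdmissible ε a) {N p h : ℕ}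
    (hp : 1 ≤ p) (hper : ∀ n, N ≤ n → a (n + p) = a n) (hh : 1 ≤ h) :
    Tendsto (fun n : ℕ => (cfDen ε a (N + n * p + h - 1 - 1) : ℝ) / cfDen ε a (N + n * p + h - 1))
      atTop (𝓝 (1 / cfValue ε (reversedPeriod (periodEntry a N) p h))) := by
  have hE : CFAdmissible' ε (reversedPeriod (periodEntry a N) p h) := hA.reversed hp hper
  set e := reversedPeriod (periodEntry a N) p h with he
  have hD : ∀ k, (0 : ℝ) < cfDen ε a k := fun k => by exact_mod_cast hA.cfDen_pos k
  have hconv := (tendsto_add_atTop_iff_nat 1).2 hE.admissible.tendsto_value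
  -- With `s + 3` periods, the `s + 2` backward steps stay inside the periodic part and all indices
  -- are genuine.
  have key : ∀ s : ℕ, dist ((cfDen ε a (N + (s + 3) * p + h - 1) : ℝ)
      / cfDen ε a (N + (s + 3) * p + h - 1 - 1)) (cfConv ε e (s + 1)) ≤ 2 / (s + 2) := by
    intro s
    have hle : s + 3 ≤ (s + 3) * p := Nat.le_mul_of_pos_right _ hp
    refine hE.admissible.abs_sub_conv_le (n := s)
      (y := fun j => (cfDen ε a (N + (s + 3) * p + h - 1 - j) : ℝ)
        / cfDen ε a (N + (s + 3) * p + h - 1 - j - 1)) (fun j hj => ?_) fun j hj => ?_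
    · rw [he, ← reversedPeriod_apply (t := s + 3) hp hper (by omega)]
      obtain ⟨i, hi⟩ : ∃ i, N + (s + 3) * p + h - 1 - j = i + 2 :=
        ⟨N + (s + 3) * p + h - 1 - j - 2, by omega⟩
      have hi1 : N + (s + 3) * p + h - 1 - (j + 1) = i + 1 := by omega
      simp only [hi, hi1]
      simp only [show i + 2 - 1 = i + 1 from rfl, show i + 1 - 1 = i from rfl]
      have h1 := (hD i).ne'
      have h2 := (hD (i + 1)).ne'
      rw [cfDen]
      push_cast
      field_simp
    · obtain ⟨i, hi⟩ : ∃ i, N + (s + 3) * p + h - 1 - (j + 1) = i + 1 :=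
        ⟨N + (s + 3) * p + h - 1 - j - 2, by omega⟩
      simp only [hi]
      rw [show i + 1 - 1 = i from rfl, one_le_div (hD i)]
      exact_mod_cast hA.cfDen_le_succ i
  have hlim : Tendsto (fun s : ℕ => (cfDen ε a (N + (s + 3) * p + h - 1) : ℝ)
      / cfDen ε a (N + (s + 3) * p + h - 1 - 1)) atTop (𝓝 (cfValue ε e)) := by
    refine (tendsto_iff_of_dist ?_).2 hconv
    exact squeeze_zero (fun _ => dist_nonneg) key (tendsto_div_natCast_add_two 2)
  rw [← tendsto_add_atTop_iff_nat 3]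
  have hv := hE.one_le_value
  have := hlim.inv₀ (by linarith : (0 : ℝ) < _).ne'
  rw [one_div]
  refine this.congr fun s => ?_
  rw [inv_div]

/-! ### The two expansions of an irrational number -/

theorem irrational_regQuot {z : ℝ} (hz : Irrational z) (j : ℕ) : Irrational (regQuot z j) := by
  induction j with
  | zero => exact hz
  | succ j ih =>
    rw [regQuot, one_div, irrational_inv_iff]
    exact ih.sub_intCast _

theorem irrational_negQuot {z : ℝ} (hz : Irrational z) (j : ℕ) : Irrational (negQuot z j) := by
  induction j with
  | zero => exact hz
  | succ j ih =>
    rw [negQuot, one_div, irrational_inv_iff]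
    exact ih.intCast_sub _

theorem Irrational.floor_lt {x : ℝ} (hx : Irrational x) : (⌊x⌋ : ℝ) < x :=
  lt_of_le_of_ne (Int.floor_le x) fun h => hx.ne_int _ h.symm

theorem Irrational.lt_ceil {x : ℝ} (hx : Irrational x) : x < ⌈x⌉ :=
  lt_of_le_of_ne (Int.le_ceil x) fun h => hx.ne_int _ h

theorem one_lt_regQuot_succ {z : ℝ} (hz : Irrational z) (j : ℕ) : 1 < regQuot z (j + 1) := by
  have h := irrational_regQuot hz j
  rw [regQuot, lt_div_iff₀ (by linarith [h.floor_lt])]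
  linarith [Int.lt_floor_add_one (regQuot z j)]

theorem one_lt_negQuot_succ {z : ℝ} (hz : Irrational z) (j : ℕ) : 1 < negQuot z (j + 1) := by
  have h := irrational_negQuot hz j
  rw [negQuot, lt_div_iff₀ (by linarith [h.lt_ceil])]
  linarith [Int.ceil_lt_add_one (negQuot z j)]

theorem regQuot_eq (z : ℝ) (j : ℕ) :
    regQuot z j = regDigit z j + (1 : ℤ) / regQuot z (j + 1) := by
  rw [regQuot, regDigit, Int.cast_one, one_div_one_div]
  ring

theorem negQuot_eq (z : ℝ) (j : ℕ) :
    negQuot z j = negDigit z j + (-1 : ℤ) / negQuot z (j + 1) := by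
  rw [negQuot, negDigit, Int.cast_neg, Int.cast_one, neg_div, one_div_one_div]
  ring

theorem regDigit_admissible {z : ℝ} (hz : Irrational z) : CFAdmissible 1 (regDigit z) :=
  Or.inl ⟨rfl, fun j => Int.le_floor.2 (by exact_mod_cast (one_lt_regQuot_succ hz j).le)⟩

theorem negDigit_admissible {z : ℝ} (hz : Irrational z) : CFAdmissible (-1) (negDigit z) :=
  Or.inr ⟨rfl, fun j => (Int.lt_ceil (z := 1)).2 (by
    rw [Int.cast_one]
    exact one_lt_negQuot_succ hz j)⟩

theorem tendsto_regConv {z : ℝ} (hz : Irrational z) :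
    Tendsto (cfConv 1 (regDigit z)) atTop (𝓝 z) :=
  (regDigit_admissible hz).tendsto_of_quot (regQuot_eq z) fun j => (one_lt_regQuot_succ hz j).le

theorem tendsto_negConv {z : ℝ} (hz : Irrational z) :
    Tendsto (cfConv (-1) (negDigit z)) atTop (𝓝 z) :=
  (negDigit_admissible hz).tendsto_of_quot (negQuot_eq z) fun j => (one_lt_negQuot_succ hz j).le

/-! ### Conversion of the regular into the negative regular expansion -/

/-- The position in the negative regular expansion that corresponds to the partial quotient
`a (2 * i)` of the regular expansion. -/
def blockStart (a : ℕ → ℤ) (i : ℕ) : ℕ := ∑ k ∈ Finset.range i, (a (2 * k + 1)).toNat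

theorem blockStart_succ (a : ℕ → ℤ) (i : ℕ) :
    blockStart a (i + 1) = blockStart a i + (a (2 * i + 1)).toNat :=
  Finset.sum_range_succ _ _

/-- While `y > 2`, the quotient `1 + 1 / (y - 1)` has digit `2` and successor `1 + 1 / (y - 2)`:
each digit `2` lowers `y` by one. -/
theorem negQuot_block {z : ℝ} {j n : ℕ} {y : ℝ} (hy : (n : ℝ) < y)
    (hj : negQuot z (j + 1) = 1 + 1 / (y - 1)) :
    (∀ t, t + 1 < n → negDigit z (j + t + 1) = 2) ∧
      ∀ t, t + 1 ≤ n → negQuot z (j + t + 1) = 1 + 1 / (y - (t + 1)) := by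
  have hd : ∀ t, t + 1 < n → negQuot z (j + t + 1) = 1 + 1 / (y - (t + 1)) →
      negDigit z (j + t + 1) = 2 := by
    intro t ht h
    have h1 : (t : ℝ) + 1 + 1 ≤ n := by exact_mod_cast ht
    have h2 : (1 : ℝ) < y - (t + 1) := by linarith
    rw [negDigit, Int.ceil_eq_iff, h]
    constructor
    · have : 0 < 1 / (y - (t + 1)) := by positivity
      push_cast
      linarith
    · have : 1 / (y - (t + 1)) ≤ 1 := by rw [div_le_one (by linarith)]; exact h2.le
      push_cast
      linarith
  have hq : ∀ t, t + 1 ≤ n → negQuot z (j + t + 1) = 1 + 1 / (y - (t + 1)) := by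
    intro t
    induction t with
    | zero => intro _; simpa using hj
    | succ t ih =>
      intro ht
      have h := ih (by omega)
      have hc := hd t (by omega) h
      have h1 : (t : ℝ) + 1 + 1 ≤ n := by exact_mod_cast ht
      have h2 : (0 : ℝ) < y - (t + 1) - 1 := by linarith
      rw [negDigit] at hc
      rw [show j + (t + 1) + 1 = j + t + 1 + 1 by ring, negQuot, hc, h]
      have e1 : y - (t + 1) ≠ 0 := by linarith
      have e2 : y - (t + 1) - 1 ≠ 0 := h2.ne'
      have e3 : ((2 : ℤ) : ℝ) - (1 + 1 / (y - (t + 1))) = (y - (t + 1) - 1) / (y - (t + 1)) := by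
        push_cast
        field_simp
        ring
      have e4 : y - ((t + 1 : ℕ) + 1 : ℝ) = y - (t + 1) - 1 := by push_cast; ring
      rw [e3, e4]
      field_simp
      ring
  exact ⟨fun t ht => hd t ht (hq t ht.le), hq⟩

/-- Used with `k = 0` at the start and with `k = 1` at the end of each run of digits `2`. -/
theorem negQuot_step {z : ℝ} {x : ℝ} {j : ℕ} {k : ℤ} (hx : Irrational x)
    (h : negQuot z j = x + k) :
    negDigit z j = ⌊x⌋ + 1 + k ∧
      negQuot z (j + 1) = 1 + 1 / (1 / (x - ⌊x⌋) - 1) := by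
  have h1 := hx.floor_lt
  have h2 := Int.lt_floor_add_one x
  have hc : negDigit z j = ⌊x⌋ + 1 + k := by
    rw [negDigit, Int.ceil_eq_iff, h]
    push_cast
    constructor <;> linarith
  refine ⟨hc, ?_⟩
  rw [negDigit] at hc
  rw [negQuot, hc, h]
  push_cast
  have e1 : x - ⌊x⌋ ≠ 0 := by linarith
  have e2 : 1 - (x - ⌊x⌋) ≠ 0 := by linarith
  have e3 : (⌊x⌋ : ℝ) + 1 + k - (x + k) = 1 - (x - ⌊x⌋) := by ring
  have e4 : 1 / (x - ⌊x⌋) - 1 = (1 - (x - ⌊x⌋)) / (x - ⌊x⌋) := by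
    rw [sub_div, div_self e1]
  rw [e3, e4]
  field_simp
  ring

theorem cast_toNat_regDigit {z : ℝ} (hz : Irrational z) (j : ℕ) :
    ((regDigit z (j + 1)).toNat : ℤ) = regDigit z (j + 1) ∧ 1 ≤ (regDigit z (j + 1)).toNat := by
  have h : 1 ≤ regDigit z (j + 1) := by
    rcases regDigit_admissible hz with h | h
    · exact h.2 j
    · exact absurd h.1 (by norm_num)
  omega

theorem negQuot_blockStart_aux {z : ℝ} (hz : Irrational z) {i : ℕ}
    (h : negQuot z (blockStart (regDigit z) i + 1) = 1 + 1 / (regQuot z (2 * i + 1) - 1)) :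
    (∀ t, t + 1 < (regDigit z (2 * i + 1)).toNat →
      negDigit z (blockStart (regDigit z) i + t + 1) = 2) ∧
    negDigit z (blockStart (regDigit z) (i + 1)) = regDigit z (2 * i + 2) + 2 ∧
    negQuot z (blockStart (regDigit z) (i + 1) + 1) = 1 + 1 / (regQuot z (2 * i + 3) - 1) := by
  obtain ⟨hn, hn1⟩ := cast_toNat_regDigit hz (2 * i)
  have hn' : ((regDigit z (2 * i + 1)).toNat : ℝ) = regDigit z (2 * i + 1) := by exact_mod_cast hn
  have hlt : ((regDigit z (2 * i + 1)).toNat : ℝ) < regQuot z (2 * i + 1) := by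
    rw [hn']
    exact (irrational_regQuot hz _).floor_lt
  obtain ⟨h1, h2⟩ := negQuot_block hlt h
  obtain ⟨t, ht⟩ := Nat.exists_eq_add_of_le' hn1
  have h3 := h2 t ht.ge
  have h4 : negQuot z (blockStart (regDigit z) (i + 1)) = regQuot z (2 * i + 2) + (1 : ℤ) := by
    rw [blockStart_succ, ht, ← add_assoc, h3, show regQuot z (2 * i + 2)
      = 1 / (regQuot z (2 * i + 1) - regDigit z (2 * i + 1)) from rfl, ← hn', ht]
    push_cast
    ring
  obtain ⟨h5, h6⟩ := negQuot_step (irrational_regQuot hz _) h4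
  refine ⟨h1, ?_, ?_⟩
  · rw [h5, regDigit]
    ring
  · rw [h6]
    rfl

theorem negQuot_blockStart {z : ℝ} (hz : Irrational z) (i : ℕ) :
    negQuot z (blockStart (regDigit z) i + 1) = 1 + 1 / (regQuot z (2 * i + 1) - 1) := by
  induction i with
  | zero =>
    have := (negQuot_step (z := z) (x := z) (j := 0) (k := 0) hz (by simp [negQuot])).2
    simpa [blockStart, regQuot] using this
  | succ i ih => exact (negQuot_blockStart_aux hz ih).2.2

theorem negDigit_zero {z : ℝ} (hz : Irrational z) : negDigit z 0 = regDigit z 0 + 1 := by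
  simpa [regDigit, regQuot] using
    (negQuot_step (z := z) (x := z) (j := 0) (k := 0) hz (by simp [negQuot])).1

/-- The conversion of the regular into the negative regular expansion. -/
theorem negDigit_eq_two {z : ℝ} (hz : Irrational z) {i t : ℕ}
    (ht : t + 1 < (regDigit z (2 * i + 1)).toNat) :
    negDigit z (blockStart (regDigit z) i + t + 1) = 2 :=
  (negQuot_blockStart_aux hz (negQuot_blockStart hz i)).1 t ht

theorem negDigit_blockStart {z : ℝ} (hz : Irrational z) (i : ℕ) :
    negDigit z (blockStart (regDigit z) (i + 1)) = regDigit z (2 * i + 2) + 2 :=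
  (negQuot_blockStart_aux hz (negQuot_blockStart hz i)).2.1

theorem strictMono_blockStart {z : ℝ} (hz : Irrational z) :
    StrictMono (blockStart (regDigit z)) := by
  refine strictMono_nat_of_lt_succ fun i => ?_
  rw [blockStart_succ]
  have := (cast_toNat_regDigit hz (2 * i)).2
  omega

/-- Between consecutive block starts all digits are `2`; the last block start up to `j + 1` must
therefore be `j + 1` itself. -/
theorem exists_blockStart {z : ℝ} (hz : Irrational z) {j : ℕ} (hj : 3 ≤ negDigit z (j + 1)) :
    ∃ i, blockStart (regDigit z) (i + 1) = j + 1 := by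
  have hmono := strictMono_blockStart hz
  have hex : ∃ i, j + 1 < blockStart (regDigit z) i :=
    ⟨j + 2, Nat.lt_of_succ_le (hmono.id_le (j + 2))⟩
  classical
  obtain ⟨i, hi⟩ : ∃ i, Nat.find hex = i + 1 := by
    refine Nat.exists_eq_succ_of_ne_zero fun h0 => ?_
    have := Nat.find_spec hex
    rw [h0] at this
    simp [blockStart] at this
  have h1 := Nat.find_spec hex
  have h2 := Nat.find_min hex (m := i) (by omega)
  rw [hi, blockStart_succ] at h1
  have hle : blockStart (regDigit z) i ≤ j + 1 := not_lt.1 h2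
  have heq : blockStart (regDigit z) i = j + 1 := by
    by_contra hne
    have := negDigit_eq_two hz (i := i) (t := j - blockStart (regDigit z) i) (by omega)
    rw [show blockStart (regDigit z) i + (j - blockStart (regDigit z) i) + 1 = j + 1 by omega] at this
    omega
  rcases i with _ | i
  · simp [blockStart] at heq
  · exact ⟨i, heq⟩

/-- Solutions of the two recurrences agree at the block starts. -/
theorem recurrence_blockStart {z : ℝ} (hz : Irrational z) {S P : ℕ → ℤ}
    (hS : ∀ j, S (j + 2) = negDigit z (j + 1) * S (j + 1) - S j)
    (hP : ∀ k, P (k + 2) = regDigit z (k + 1) * P (k + 1) + P k)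
    (h0 : S 0 = P 0) (h1 : S 1 = P 1 + P 0) (i : ℕ) :
    S (blockStart (regDigit z) i) = P (2 * i) ∧
      S (blockStart (regDigit z) i + 1) = P (2 * i + 1) + P (2 * i) := by
  induction i with
  | zero => exact ⟨by simpa [blockStart] using h0, by simpa [blockStart] using h1⟩
  | succ i ih =>
    set K := blockStart (regDigit z) i
    obtain ⟨hn, hn1⟩ := cast_toNat_regDigit hz (2 * i)
    obtain ⟨n, hn2⟩ := Nat.exists_eq_add_of_le' hn1
    -- Along digits `2` the recurrence makes `S` an arithmetic progression, here with difference `P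
    -- (2 * i + 1)`.
    have hlin : ∀ t, t ≤ n → S (K + t) = P (2 * i) + t * P (2 * i + 1) ∧
        S (K + t + 1) = P (2 * i) + (t + 1) * P (2 * i + 1) := by
      intro t
      induction t with
      | zero => intro _; exact ⟨by simpa using ih.1, by simpa [add_comm] using ih.2⟩
      | succ t iht =>
        intro ht
        obtain ⟨e1, e2⟩ := iht (by omega)
        refine ⟨by rw [← add_assoc, e2]; push_cast; ring, ?_⟩
        rw [show K + (t + 1) + 1 = K + t + 2 by ring, hS, e1, e2, negDigit_eq_two hz (by omega)]
        push_cast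
        ring
    obtain ⟨e1, e2⟩ := hlin n le_rfl
    have hK : blockStart (regDigit z) (i + 1) = K + n + 1 := by rw [blockStart_succ, hn2]; rfl
    have hd := negDigit_blockStart hz i
    have hPi := hP (2 * i)
    have hPi' := hP (2 * i + 1)
    rw [← hn, hn2] at hPi
    push_cast at hPi
    rw [hK] at hd ⊢
    rw [show 2 * (i + 1) = 2 * i + 2 by ring, show K + n + 1 + 1 = K + n + 2 by ring, hS, hd, e1, e2]
    rw [show 2 * i + 2 + 1 = 2 * i + 1 + 2 by ring, hPi', hPi]
    simp only [show 2 * i + 1 + 1 = 2 * i + 2 from rfl]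
    constructor <;> ring

theorem conv_blockStart {z : ℝ} (hz : Irrational z) {i j : ℕ}
    (hij : blockStart (regDigit z) (i + 1) = j + 1) :
    cfNum (-1) (negDigit z) j = cfNum 1 (regDigit z) (2 * i + 1) ∧
      cfDen (-1) (negDigit z) j = cfDen 1 (regDigit z) (2 * i + 1) := by
  have hc := negDigit_zero hz
  -- The sequences are preceded by the convergent `1/0` of index `-1`: `1` for numerators, `0` for
  -- denominators below.
  have h1 := (recurrence_blockStart hz (S := fun j => Nat.casesOn j 1 (cfNum (-1) (negDigit z)))
    (P := fun j => Nat.casesOn j 1 (cfNum 1 (regDigit z)))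
    (fun j => by cases j <;> (simp [cfNum]; ring)) (fun j => by cases j <;> simp [cfNum])
    rfl (by simp [cfNum, hc]) (i + 1)).1
  have h2 := (recurrence_blockStart hz (S := fun j => Nat.casesOn j 0 (cfDen (-1) (negDigit z)))
    (P := fun j => Nat.casesOn j 0 (cfDen 1 (regDigit z)))
    (fun j => by cases j <;> simp [cfDen]; ring) (fun j => by cases j <;> simp [cfDen])
    rfl (by simp [cfDen]) (i + 1)).1
  rw [hij] at h1 h2
  exact ⟨h1, h2⟩

/-- A block contributes `a_{2i+1} - 1` from its digits `2` and `1 - a_{2i+2}` from its last digit.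
The constant `2` comes from `3 - c_0 = 2 - a_0`. -/
theorem sum_negDigit_blockStart {z : ℝ} (hz : Irrational z) (i : ℕ) :
    ∑ j ∈ Finset.range (blockStart (regDigit z) i + 1), (3 - negDigit z j)
      = (∑ k ∈ Finset.range (2 * i + 1), (-1) ^ (k + 1) * regDigit z k) + 2 := by
  induction i with
  | zero =>
    simp [blockStart, negDigit_zero hz]
    ring
  | succ i ih =>
    obtain ⟨hn, hn1⟩ := cast_toNat_regDigit hz (2 * i)
    obtain ⟨n, hn2⟩ := Nat.exists_eq_add_of_le' hn1
    have hK : blockStart (regDigit z) (i + 1) = blockStart (regDigit z) i + 1 + n := by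
      rw [blockStart_succ, hn2]; ring
    have hd := negDigit_blockStart hz i
    rw [Finset.sum_range_succ, hd, hK, Finset.sum_range_add, ih]
    have e : ∀ t ∈ Finset.range n, (3 - negDigit z (blockStart (regDigit z) i + 1 + t)) = 1 := by
      intro t ht
      have ht' := Finset.mem_range.1 ht
      rw [add_right_comm, negDigit_eq_two hz (by omega)]
      norm_num
    rw [Finset.sum_congr rfl e, show 2 * (i + 1) + 1 = 2 * i + 1 + 1 + 1 by ring,
      Finset.sum_range_succ _ (2 * i + 1 + 1), Finset.sum_range_succ _ (2 * i + 1), ← hn, hn2]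
    have s1 : (-1 : ℤ) ^ (2 * i + 1 + 1) = 1 := Even.neg_one_pow ⟨i + 1, by ring⟩
    rw [pow_succ _ (2 * i + 1 + 1), s1]
    simp
    ring

/-! ### Periods and digit sums -/

theorem IsMinimalPeriod.pos {a : ℕ → ℤ} {N l : ℕ} (h : IsMinimalPeriod a N l) : 1 ≤ l := h.1.1.1

theorem IsMinimalPeriod.add_eq {a : ℕ → ℤ} {N l : ℕ} (h : IsMinimalPeriod a N l) :
    ∀ n, N ≤ n → a (n + l) = a n := h.2.1

theorem IsMinimalPeriod.add_evenPeriod {a : ℕ → ℤ} {N l : ℕ} (h : IsMinimalPeriod a N l) :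
    ∀ n, N ≤ n → a (n + evenPeriod l) = a n := by
  intro n hn
  unfold evenPeriod
  split_ifs
  · exact h.add_eq n hn
  · exact periodic_add_mul h.add_eq 2 n hn

theorem even_evenPeriod (l : ℕ) : Even (evenPeriod l) := by
  unfold evenPeriod
  split_ifs with h
  · exact h
  · exact even_two_mul l

theorem two_le_evenPeriod {l : ℕ} (hl : 1 ≤ l) : 2 ≤ evenPeriod l := by
  obtain ⟨k, hk⟩ := even_evenPeriod l
  have : l ≤ evenPeriod l := by
    unfold evenPeriod
    split_ifs <;> omega
  omega

/-- The increment over a period of the partial sums of an eventually periodic sequence. -/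
theorem sum_range_add_period {G : Type*} [AddCommGroup G] {f : ℕ → G} {N p : ℕ}
    (hper : ∀ n, N ≤ n → f (n + p) = f n) {σ : G} (hσ : ∑ k ∈ Finset.range p, f (N + k) = σ)
    {n : ℕ} (hn : N ≤ n) (t : ℕ) :
    ∑ k ∈ Finset.range (n + t * p), f k = ∑ k ∈ Finset.range n, f k + t • σ := by
  have one : ∀ n, N ≤ n → ∑ k ∈ Finset.range (n + p), f k = ∑ k ∈ Finset.range n, f k + σ := by
    intro n hn
    induction n, hn using Nat.le_induction with
    | base => rw [Finset.sum_range_add, hσ]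
    | succ n hn ih =>
      rw [add_right_comm, Finset.sum_range_succ, ih, hper n hn, Finset.sum_range_succ]
      abel
  induction t with
  | zero => simp
  | succ t ih =>
    rw [Nat.succ_mul, ← add_assoc, one _ (by omega), ih, succ_nsmul, add_assoc]

theorem bounded_sum_range {f : ℕ → ℤ} {N p : ℕ} (hp : 1 ≤ p)
    (hper : ∀ n, N ≤ n → f (n + p) = f n) (hσ : ∑ k ∈ Finset.range p, f (N + k) = 0) :
    ∃ B : ℤ, ∀ n, |∑ k ∈ Finset.range n, f k| ≤ B := by
  refine ⟨∑ n ∈ Finset.range (N + p), |∑ k ∈ Finset.range n, f k|, fun n => ?_⟩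
  obtain ⟨n', hn', h⟩ : ∃ n' < N + p, ∑ k ∈ Finset.range n, f k = ∑ k ∈ Finset.range n', f k := by
    rcases lt_or_ge n N with hn | hn
    · exact ⟨n, by omega, rfl⟩
    · refine ⟨N + (n - N) % p, by have := Nat.mod_lt (n - N) hp; omega, ?_⟩
      have := sum_range_add_period hper hσ (n := N + (n - N) % p) (by omega) ((n - N) / p)
      rw [smul_zero, add_zero] at this
      rw [← this]
      congr 2
      have := Nat.mod_add_div (n - N) p
      rw [mul_comm p] at this
      omega
  rw [h]
  exact Finset.single_le_sum (f := fun n => |∑ k ∈ Finset.range n, f k|)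
    (fun _ _ => abs_nonneg _) (Finset.mem_range.2 hn')

theorem sum_Icc_one_periodEntry {G : Type*} [AddCommMonoid G] (g : ℤ → G) (a : ℕ → ℤ) (N h : ℕ) :
    ∑ k ∈ Finset.Icc 1 h, g (periodEntry a N k) = ∑ k ∈ Finset.range h, g (a (N + k)) := by
  rw [Finset.range_eq_Ico, ← Finset.Ico_add_one_right_eq_Icc,
    Finset.sum_Ico_eq_sum_range, Finset.sum_Ico_eq_sum_range]
  refine Finset.sum_congr rfl fun k _ => ?_
  rw [periodEntry, zero_add, show N + (1 + k) - 1 = N + k by omega]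

theorem sum_negDigit_period {c : ℕ → ℤ} {M m : ℕ} (hm : 1 ≤ m)
    (hD : periodMean (periodEntry c M) m = 3) :
    ∑ k ∈ Finset.range m, (3 - c (M + k)) = 0 := by
  have hm' : (m : ℝ) ≠ 0 := by exact_mod_cast (by omega : m ≠ 0)
  rw [periodMean, sum_Icc_one_periodEntry (fun x : ℤ => (x : ℝ))] at hD
  have h : ∑ k ∈ Finset.range m, (c (M + k) : ℝ) = 3 * m := by
    field_simp at hD
    linarith
  have : ((∑ k ∈ Finset.range m, (3 - c (M + k)) : ℤ) : ℝ) = 0 := by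
    push_cast
    rw [Finset.sum_sub_distrib, h]
    simp
    ring
  exact_mod_cast this

theorem alternating_period {a : ℕ → ℤ} {N L : ℕ} (hL : Even L)
    (hper : ∀ n, N ≤ n → a (n + L) = a n) (n : ℕ) (hn : N ≤ n) :
    (-1 : ℤ) ^ (n + L + 1) * a (n + L) = (-1) ^ (n + 1) * a n := by
  rw [hper n hn, add_right_comm, pow_add, hL.neg_one_pow, mul_one]

/-- If the negative regular digits have mean `3` over a period, then the alternating sum of the
regular digits over an even period vanishes. -/
theorem sum_regDigit_period {z : ℝ} (hz : Irrational z) {N L M m : ℕ} (hm : 1 ≤ m) (hL : Even L)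
    (hreg : ∀ n, N ≤ n → regDigit z (n + L) = regDigit z n)
    (hneg : ∀ n, M ≤ n → negDigit z (n + m) = negDigit z n)
    (hD : ∑ k ∈ Finset.range m, (3 - negDigit z (M + k)) = 0) :
    ∑ k ∈ Finset.range L, (-1) ^ (N + k + 1) * regDigit z (N + k) = 0 := by
  obtain ⟨B, hB⟩ := bounded_sum_range (f := fun j => 3 - negDigit z j) hm
    (fun n hn => by rw [hneg n hn]) hD
  set σ := ∑ k ∈ Finset.range L, (-1) ^ (N + k + 1) * regDigit z (N + k) with hσ
  set A := ∑ k ∈ Finset.range (2 * N + 1), (-1) ^ (k + 1) * regDigit z k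
  obtain ⟨r, hr⟩ := hL
  -- By `sum_negDigit_blockStart`, `A + t * σ` is a bounded sum minus `2`. The length `2 * N + 1` is
  -- odd, as that lemma needs, and reaches past the pre-period.
  have hbd : ∀ t : ℕ, |A + t * σ| ≤ B + 2 := by
    intro t
    have h1 := sum_range_add_period (f := fun k => (-1) ^ (k + 1) * regDigit z k)
      (alternating_period ⟨r, hr⟩ hreg) hσ.symm (n := 2 * N + 1) (by omega) t
    have h2 := sum_negDigit_blockStart hz (N + t * r)
    rw [show 2 * (N + t * r) + 1 = 2 * N + 1 + t * L by rw [hr]; ring, h1, nsmul_eq_mul] at h2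
    have h3 := hB (blockStart (regDigit z) (N + t * r) + 1)
    rw [h2] at h3
    rw [abs_le] at h3 ⊢
    constructor <;> linarith [h3.1, h3.2]
  by_contra h0
  have h1 : 1 ≤ |σ| := Int.one_le_abs h0
  have hB0 : 0 ≤ B + 2 := (abs_nonneg _).trans (hbd 0)
  have h2 := hbd (B + 2 + |A| + 1).toNat
  rw [Int.toNat_of_nonneg (by positivity)] at h2
  have h3 : |(B + 2 + |A| + 1) * σ| ≤ B + 2 + |A| := by
    calc |(B + 2 + |A| + 1) * σ| = |(A + (B + 2 + |A| + 1) * σ) - A| := by congr 1; ring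
      _ ≤ |A + (B + 2 + |A| + 1) * σ| + |A| := abs_sub _ _
      _ ≤ _ := by linarith
  rw [abs_mul, abs_of_nonneg (by positivity : 0 ≤ B + 2 + |A| + 1)] at h3
  nlinarith [abs_nonneg A]

/-! ### Limits along residue classes -/

theorem tendsto_index {N p h : ℕ} (hp : 1 ≤ p) :
    Tendsto (fun n : ℕ => N + n * p + h - 1) atTop atTop := by
  refine tendsto_atTop_mono (fun n => ?_) (tendsto_sub_atTop_nat 1)
  have : n ≤ n * p := Nat.le_mul_of_pos_right _ hp
  omega

theorem odd_index {N L h n : ℕ} (hL : Even L) (hh : 1 ≤ h) :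
    Odd ((N : ℤ) - 1 + h) ↔ Odd (N + n * L + h - 1) := by
  obtain ⟨r, rfl⟩ := hL
  rw [← Int.odd_coe_nat]
  have : ((N + n * (r + r) + h - 1 : ℕ) : ℤ) = ((N : ℤ) - 1 + h) + 2 * (n * r) := by
    push_cast [show 1 ≤ N + n * (r + r) + h by omega]
    ring
  rw [this]
  generalize (N : ℤ) - 1 + h = x
  rw [Int.odd_add]
  simp

theorem tendsto_regCluster {z : ℝ} (hz : Irrational z) {N l : ℕ}
    (hreg : IsMinimalPeriod (regDigit z) N l)
    (hσ : ∑ k ∈ Finset.range (evenPeriod l), (-1) ^ (N + k + 1) * regDigit z (N + k) = 0)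
    {h : ℕ} (hh : 1 ≤ h) :
    Tendsto (fun n : ℕ =>
      dedekindS (regNum (regDigit z) (N + n * evenPeriod l + h - 1))
        (regDen (regDigit z) (N + n * evenPeriod l + h - 1))) atTop (𝓝 (regCluster z N l h)) := by
  have hA := regDigit_admissible hz
  have hL2 := two_le_evenPeriod hreg.pos
  have hLe := even_evenPeriod l
  have hper := hreg.add_evenPeriod
  simp only [regNum_eq_cfNum, regDen_eq_cfDen, regCluster, regValue_eq_cfValue]
  set a := regDigit z
  set L := evenPeriod l
  set u := cfValue 1 (reversedPeriod (periodEntry a N) L h)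
  have hratio := hA.tendsto_den_ratio (h := h) (by omega : 1 ≤ L) hper hh
  have hconv := (tendsto_regConv hz).comp (tendsto_index (N := N) (h := h) (by omega : 1 ≤ L))
  set W : ℝ := (∑ k ∈ Finset.range N, (-1 : ℝ) ^ (k + 1) * a k)
    + (-1 : ℝ) ^ (N + 1) * ∑ k ∈ Finset.Icc 1 h, (-1 : ℝ) ^ (k + 1) * periodEntry a N k with hW
  have hsum : ∀ n, ∑ j ∈ Finset.range (N + n * L + h), (-1 : ℝ) ^ (j + 1) * a j = W := by
    intro n
    have h1 := sum_range_add_period (f := fun k => (-1) ^ (k + 1) * a k)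
      (alternating_period hLe hper) hσ (n := N + h) (by omega) n
    rw [smul_zero, add_zero] at h1
    have h2 : ∑ j ∈ Finset.range (N + n * L + h), (-1 : ℝ) ^ (j + 1) * a j
        = ∑ j ∈ Finset.range (N + h), (-1 : ℝ) ^ (j + 1) * a j := by
      rw [show N + n * L + h = N + h + n * L by ring]
      exact_mod_cast h1
    rw [h2, Finset.sum_range_add, hW, ← Finset.Ico_add_one_right_eq_Icc,
      Finset.sum_Ico_eq_sum_range, Finset.mul_sum]
    congr 1
    refine Finset.sum_congr rfl fun k _ => ?_
    rw [periodEntry, show N + (1 + k) - 1 = N + k by omega]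
    ring
  have hlim : Tendsto (fun n : ℕ => W + cfConv 1 a (N + n * L + h - 1)
      + (if Odd ((N : ℤ) - 1 + h) then 1 else -1) * ((cfDen 1 a (N + n * L + h - 1 - 1) : ℝ)
        / cfDen 1 a (N + n * L + h - 1)) - if Odd ((N : ℤ) - 1 + h) then 3 else 0) atTop
      (𝓝 (W + z + (if Odd ((N : ℤ) - 1 + h) then 1 else -1) * (1 / u)
        - if Odd ((N : ℤ) - 1 + h) then 3 else 0)) :=
    ((hconv.const_add _).add (hratio.const_mul _)).sub_const _
  have hval : (W + z + (if Odd ((N : ℤ) - 1 + h) then 1 else -1) * (1 / u)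
        - if Odd ((N : ℤ) - 1 + h) then 3 else 0)
      = W + if Odd ((N : ℤ) - 1 + h) then z + 1 / u - 3 else z - 1 / u := by
    split_ifs <;> ring
  rw [← hval]
  refine hlim.congr' ?_
  -- For `n ≥ 1` the index is positive, as `dedekindS_regular` requires.
  filter_upwards [eventually_ge_atTop 1] with n hn
  have hle : n ≤ n * L := Nat.le_mul_of_pos_right _ (by omega)
  obtain ⟨k, hk⟩ : ∃ k, N + n * L + h - 1 = k + 1 := ⟨N + n * L + h - 2, by omega⟩
  have hodd : Odd ((N : ℤ) - 1 + h) ↔ Even k := by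
    rw [odd_index (n := n) hLe hh, hk]
    simp [Nat.odd_add_one]
  rw [hk, dedekindS_regular hA, ← hsum n, show N + n * L + h = k + 2 by omega]
  simp only [hodd]
  rcases Nat.even_or_odd k with he | ho
  · simp [he, he.neg_one_pow, cfConv]
  · simp [Nat.not_even_iff_odd.2 ho, ho.neg_one_pow, cfConv]

theorem tendsto_negCluster {z : ℝ} (hz : Irrational z) {M m : ℕ}
    (hneg : IsMinimalPeriod (negDigit z) M m)
    (hσ : ∑ k ∈ Finset.range m, (3 - negDigit z (M + k)) = 0) {i : ℕ} (hi : 1 ≤ i) :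
    Tendsto (fun n : ℕ =>
      dedekindS (negNum (negDigit z) (M + n * m + i - 1))
        (negDen (negDigit z) (M + n * m + i - 1))) atTop (𝓝 (negCluster z M m i)) := by
  have hA := negDigit_admissible hz
  have hm := hneg.pos
  have hper := hneg.add_eq
  simp only [negNum_eq_cfNum, negDen_eq_cfDen, negCluster, negValue_eq_cfValue]
  rw [sum_Icc_one_periodEntry (fun x : ℤ => 3 - (x : ℝ))]
  set c := negDigit z
  set v := cfValue (-1) (reversedPeriod (periodEntry c M) m i)
  have hratio := hA.tendsto_den_ratio (h := i) hm hper hi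
  have hconv := (tendsto_negConv hz).comp (tendsto_index (N := M) (h := i) hm)
  have hsum : ∀ n, ∑ j ∈ Finset.range (M + n * m + i), (3 - (c j : ℝ))
      = ∑ j ∈ Finset.range M, (3 - (c j : ℝ)) + ∑ j ∈ Finset.range i, (3 - (c (M + j) : ℝ)) := by
    intro n
    have h1 := sum_range_add_period (f := fun k => 3 - c k)
      (fun n hn => by rw [hper n hn]) hσ (n := M + i) (by omega) n
    rw [smul_zero, add_zero] at h1
    rw [← Finset.sum_range_add, show M + n * m + i = M + i + n * m by ring]
    exact_mod_cast h1
  refine (((hconv.const_add _).sub hratio).sub_const 3).congr' ?_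
  filter_upwards [eventually_ge_atTop 1] with n hn
  have hle : n ≤ n * m := Nat.le_mul_of_pos_right _ hm
  obtain ⟨k, hk⟩ : ∃ k, M + n * m + i - 1 = k + 1 := ⟨M + n * m + i - 2, by omega⟩
  simp only [Function.comp_apply]
  rw [hk, dedekindS_negative hA, ← hsum n, show M + n * m + i = k + 2 by omega]
  rfl

/-! ### Coincidence and non-coincidence of cluster points -/

theorem exists_regCluster_eq {z : ℝ} (hz : Irrational z) {N l M m : ℕ}
    (hreg : IsMinimalPeriod (regDigit z) N l) (hneg : IsMinimalPeriod (negDigit z) M m)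
    (hreglim : ∀ h ∈ Finset.Icc 1 (evenPeriod l),
      Tendsto (fun n : ℕ =>
          dedekindS (regNum (regDigit z) (N + n * evenPeriod l + h - 1))
            (regDen (regDigit z) (N + n * evenPeriod l + h - 1)))
        atTop (𝓝 (regCluster z N l h)))
    {i : ℕ} (hi : i ∈ Finset.Icc 1 m) (h3 : 3 ≤ periodEntry (negDigit z) M (i % m + 1))
    (hneglim : Tendsto (fun n : ℕ =>
          dedekindS (negNum (negDigit z) (M + n * m + i - 1))
            (negDen (negDigit z) (M + n * m + i - 1)))
        atTop (𝓝 (negCluster z M m i))) :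
    ∃ h ∈ Finset.Icc 1 (evenPeriod l),
      Odd ((N : ℤ) - 1 + h) ∧ negCluster z M m i = regCluster z N l h := by
  obtain ⟨hi1, him⟩ := Finset.mem_Icc.1 hi
  have hL2 := two_le_evenPeriod hreg.pos
  have hLe := even_evenPeriod l
  set L := evenPeriod l
  -- The digit after the convergent of index `r + nm + i` is `d_{i+1}`, so it sits at a block start.
  have hdig : ∀ n, ∃ b, blockStart (regDigit z) (b + 1) = M + n * m + i - 1 + 1 := by
    intro n
    refine exists_blockStart hz (h3.trans_eq ?_)
    rw [periodEntry, show M + (i % m + 1) - 1 = M + i % m by omega,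
      show M + n * m + i - 1 + 1 = M + i + n * m by omega,
      periodic_add_mul hneg.add_eq n _ (by omega)]
    rcases him.eq_or_lt with rfl | hlt
    · rw [Nat.mod_self, hneg.add_eq _ (by omega), add_zero]
    · rw [Nat.mod_eq_of_lt hlt]
  choose β hβ using hdig
  have hinj : Function.Injective β := by
    intro n n' hnn
    have h1 := hβ n
    rw [hnn, hβ n'] at h1
    exact Nat.eq_of_mul_eq_mul_right hneg.pos (by omega : n * m = n' * m)
  have hβtop : Tendsto β atTop atTop := hinj.nat_tendsto_atTop
  -- Pigeonhole: some residue of `2 * β n + 1 - N` mod `L` recurs infinitely often, and `h = r + 1`.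
  -- Adding `N * L` keeps the subtraction from being truncated.
  have hfreq : ∃ r ∈ Finset.range L, ∃ᶠ n in atTop, (2 * β n + 1 + N * L - N) % L = r := by
    by_contra hcon
    push Not at hcon
    have hall := (Finset.eventually_all (Finset.range L)).2 hcon
    obtain ⟨n, hn⟩ := hall.exists
    exact hn _ (Finset.mem_range.2 (Nat.mod_lt _ (by omega))) rfl
  obtain ⟨r, hr, hfr⟩ := hfreq
  have hr' := Finset.mem_range.1 hr
  have hmem : r + 1 ∈ Finset.Icc 1 L := Finset.mem_Icc.2 ⟨by omega, hr'⟩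
  have htop : Tendsto (fun n => (2 * β n + 1 - N) / L) atTop atTop := by
    refine (Nat.tendsto_div_const_atTop (by omega)).comp ?_
    exact tendsto_atTop_mono (fun n => by simp only [Function.comp_apply]; omega)
      ((tendsto_sub_atTop_nat N).comp hβtop)
  have hev : ∀ᶠ n in atTop, N ≤ 2 * β n + 1 := by
    filter_upwards [hβtop.eventually_ge_atTop N] with n hn
    omega
  have hidx : ∀ n, N ≤ 2 * β n + 1 → (2 * β n + 1 + N * L - N) % L = r →
      N + (2 * β n + 1 - N) / L * L + (r + 1) - 1 = 2 * β n + 1 := by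
    intro n hN h
    rw [show 2 * β n + 1 + N * L - N = 2 * β n + 1 - N + N * L by omega,
      Nat.add_mul_mod_self_right] at h
    have := Nat.mod_add_div (2 * β n + 1 - N) L
    rw [h, mul_comm L] at this
    omega
  refine ⟨r + 1, hmem, ?_, ?_⟩
  · obtain ⟨n, hn, hN⟩ := (hfr.and_eventually hev).exists
    rw [odd_index (n := (2 * β n + 1 - N) / L) hLe (by omega), hidx n hN hn]
    exact ⟨β n, rfl⟩
  · refine tendsto_nhds_unique_of_frequently_eq hneglim ((hreglim _ hmem).comp htop) ?_
    refine (hfr.and_eventually hev).mono fun n ⟨hn, hN⟩ => ?_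
    obtain ⟨e1, e2⟩ := conv_blockStart hz (hβ n)
    simp only [Function.comp_apply]
    rw [hidx n hN hn, negNum_eq_cfNum, negDen_eq_cfDen, regNum_eq_cfNum, regDen_eq_cfDen, e1, e2]

theorem regCluster_ne_negCluster {z : ℝ} (hz : Irrational z) {N l M m : ℕ}
    (hreg : IsMinimalPeriod (regDigit z) N l) (hneg : IsMinimalPeriod (negDigit z) M m) {h i : ℕ}
    (heven : Even ((N : ℤ) - 1 + h)) : regCluster z N l h ≠ negCluster z M m i := by
  intro heq
  have hL2 := two_le_evenPeriod hreg.pos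
  have hm := hneg.pos
  have hE := (regDigit_admissible hz).reversed (h := h) (by omega : 1 ≤ evenPeriod l)
    hreg.add_evenPeriod
  have hF := (negDigit_admissible hz).reversed (h := i) hm hneg.add_eq
  simp only [regCluster, negCluster, regValue_eq_cfValue, negValue_eq_cfValue,
    if_neg (Int.not_odd_iff_even.2 heven)] at heq
  have he : ∀ j, 1 ≤ reversedPeriod (periodEntry (regDigit z) N) (evenPeriod l) h j := by
    rcases hE with H | H
    · exact H.2
    · exact absurd H.1 (by norm_num)
  have hf : ∀ j, 2 ≤ reversedPeriod (periodEntry (negDigit z) M) m i j := by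
    rcases hF with H | H
    · exact absurd H.1 (by norm_num)
    · exact H.2
  -- The negative period is doubled because `m = 1` is possible.
  have hne := value_one_ne_value_neg_one he hf hL2 (by omega : 2 ≤ 2 * m)
    (reversedPeriod_add _ _ _) fun j => by
      rw [two_mul, ← add_assoc, reversedPeriod_add, reversedPeriod_add]
  have hu := hE.one_le_value
  have hv := hF.one_le_value
  have hirr := irrational_value_one he
  generalize cfValue 1 _ = u at *
  generalize cfValue (-1) _ = v at *
  -- Strictness here gives `1 / u < 1`; as only `1 / v ≤ 1` is at hand, `1 / u - 1 / v > -1` needs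
  -- just `1 / u > 0`, and `< 1` comes from this.
  have hu1 : 1 < u := lt_of_le_of_ne hu fun h1 => hirr.ne_one h1.symm
  obtain ⟨k, hk⟩ : ∃ k : ℤ, 1 / u - 1 / v = k := by
    refine ⟨(∑ k ∈ Finset.range N, (-1) ^ (k + 1) * regDigit z k)
      + (-1) ^ (N + 1) * (∑ k ∈ Finset.Icc 1 h, (-1) ^ (k + 1) * periodEntry (regDigit z) N k)
      - ((∑ j ∈ Finset.range M, (3 - negDigit z j))
        + (∑ j ∈ Finset.Icc 1 i, (3 - periodEntry (negDigit z) M j)) - 3), ?_⟩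
    push_cast
    linarith
  have b1 : 0 < 1 / u := by positivity
  have b2 : 1 / u < 1 := by rw [div_lt_one (by linarith)]; exact hu1
  have b3 : 0 < 1 / v := by positivity
  have b4 : 1 / v ≤ 1 := by rw [div_le_one (by linarith)]; exact hv
  have k1 : (-1 : ℝ) < k := by linarith
  have k2 : (k : ℝ) < 1 := by linarith
  have k0 : k = 0 := by
    have : (-1 : ℤ) < k := by exact_mod_cast k1
    have : k < 1 := by exact_mod_cast k2
    omega
  rw [k0, Int.cast_zero, sub_eq_zero, one_div, one_div, inv_inj] at hk
  exact hne hk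

/-- Here `N = q + 1` and `M = r + 1` are the lengths of the pre-periods, `L = evenPeriod l`, and
`d_{i+1}` is read cyclically (`d_{m+1} = d_1`). The first two parts say that `U_h` and `V_i` are
the limits of the Dedekind sums along the classes `k = q + n L + h` and `j = r + n m + i`; the
last two parts are the coincidence statements. -/
theorem theorem4 (z : ℝ) (hz : IsQuadraticIrrational z) (N l M m : ℕ)
    (hreg : IsMinimalPeriod (regDigit z) N l) (hneg : IsMinimalPeriod (negDigit z) M m)
    (hD : periodMean (periodEntry (negDigit z) M) m = 3) :
    (∀ h ∈ Finset.Icc 1 (evenPeriod l),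
      Tendsto (fun n : ℕ =>
          dedekindS (regNum (regDigit z) (N + n * evenPeriod l + h - 1))
            (regDen (regDigit z) (N + n * evenPeriod l + h - 1)))
        atTop (𝓝 (regCluster z N l h))) ∧
    (∀ i ∈ Finset.Icc 1 m,
      Tendsto (fun n : ℕ =>
          dedekindS (negNum (negDigit z) (M + n * m + i - 1))
            (negDen (negDigit z) (M + n * m + i - 1)))
        atTop (𝓝 (negCluster z M m i))) ∧
    (∀ i ∈ Finset.Icc 1 m, 3 ≤ periodEntry (negDigit z) M (i % m + 1) →
      ∃ h ∈ Finset.Icc 1 (evenPeriod l),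
        Odd ((N : ℤ) - 1 + h) ∧ negCluster z M m i = regCluster z N l h) ∧
    (∀ h ∈ Finset.Icc 1 (evenPeriod l), Even ((N : ℤ) - 1 + h) →
      ∀ i ∈ Finset.Icc 1 m, regCluster z N l h ≠ negCluster z M m i) := by
  have hirr := hz.1
  have hσ' := sum_negDigit_period hneg.pos hD
  have hσ := sum_regDigit_period hirr hneg.pos (even_evenPeriod l) hreg.add_evenPeriod
    hneg.add_eq hσ'
  have hreglim := fun h (hh : h ∈ Finset.Icc 1 (evenPeriod l)) =>
    tendsto_regCluster hirr hreg hσ (Finset.mem_Icc.1 hh).1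
  have hneglim := fun i (hi : i ∈ Finset.Icc 1 m) =>
    tendsto_negCluster hirr hneg hσ' (Finset.mem_Icc.1 hi).1
  exact ⟨hreglim, hneglim, fun i hi h3 =>
    exists_regCluster_eq hirr hreg hneg hreglim hi h3 (hneglim i hi),
    fun _ _ heven _ _ => regCluster_ne_negCluster hirr hreg hneg heven⟩
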